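/- **IntSet correctness.** Fix $k\in\mathbb N$ and let $w=2^k$ (commonly $w=64$). Big-endian Patricia trees with bitmap leaves are the terms $$s ::= \mathtt{Bin}\ p'\ m\ s_1\ s_2 \mid \mathtt{Tip}\ p'\ \mathit{bm}\mid \mathtt{Nil},\qquad p',m,\mathit{bm}\in\mathbb N.$$ For $p,b\in\mathbb N$ let $d(p,b)=\{p2^b,\dots,(p+1)2^b-1\}$ be a *dyadic interval*; for $b>0$ its halves are $h_1(d(p,b))=d(2p,b-1)$ and $h_2(d(p,b))=d(2p+1,b-1)$. Dyadic intervals are ordered by inclusion, and $r_1\sqcup r_2$ denotes the least dyadic interval containing $r_1$ and $r_2$. For a tree $s$, a dyadic interval $r$ and a set $D\subseteq\mathbb N$, the relation $s::r::D$ is defined inductively by - $\mathtt{Tip}\ p'\ \mathit{bm}::d(p,k)::\{pw+j\mid \text{bit } j \text{ of } \mathit{bm}\text{ is set}\}$ if $p'=pw$ and $0<\mathit{bm}<2^w$; - $\mathtt{Bin}\ p'\ m\ s_1\ s_2::d(p,b)::D_1\cup D_2$ if $s_1::r_1::D_1$, $s_2::r_2::D_2$, $r_1\subseteq h_1(d(p,b))$,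 $r_2\subseteq h_2(d(p,b))$, $b>0$, $p'=p2^b$ and $m=2^{b-1}$. Write $s::D$ if either $s=\mathtt{Nil}$ and $D=\emptyset$, or $s::r::D$ for some $r$; call $s$ *well-formed*, $\mathrm{WF}\,s$, if $s::D$ for some $D$. Write $s::_0r'::D$ if either $s=\mathtt{Nil}$ and $D=\emptyset$, or $s::r::D$ for some $r\subseteq r'$. The operations below are those of Haskell's `Data.IntSet` (containers 0.5.11.0), with keys, prefixes and masks in $\mathbb N$ and bitmaps that are $w$-bit words. Then the following hold. 1. Dyadic intervals are non-empty. Two of them are disjoint or one contains the other. If $b>0$, then $d(p,b)$ is the disjoint union of its two halves, and a dyadic interval that meets both halves contains $d(p,b)$. Any two dyadic intervals $r_1,r_2$ have a least upper bound $r_1\sqcup r_2$ among the dyadic intervals. 2. If $s::r::D$, then $\emptyset\ne D\subseteq r$, and $r$ is the smallest among the dyadic intervals of length at least $w$ that contain $D$. 3. If $s_1::r_1::D$ and $s_2::r_2::D$, then $r_1=r_2$ and $s_1=s_2$. If $s_1::D$ and $s_2::D$, then $s_1=s_2$. 4. If $s::D$, then $\mathtt{member}\ x\ s=\mathtt{true}$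 iff $x\in D$. 5. If $s_1::D_1$ and $s_2::D_2$, then: $\mathtt{null}\ s_1=\mathtt{true}$ iff $D_1=\emptyset$; $D_1$ is finite and $\mathtt{size}\ s_1=|D_1|$; $\mathtt{toList}\ s_1$ is a duplicate-free list whose elements are exactly those of $D_1$; $\mathtt{equal}\ s_1\ s_2=\mathtt{true}$ iff $D_1=D_2$; $\mathtt{nequal}\ s_1\ s_2=\mathtt{true}$ iff $D_1\ne D_2$; $\mathtt{isSubsetOf}\ s_1\ s_2=\mathtt{true}$ iff $D_1\subseteq D_2$. 6. If $s_1::D_1$ and $s_2::D_2$, then for every $x\in\mathbb N$, every $f:\mathbb N\to\{\mathtt{true},\mathtt{false}\}$ and every list $xs$ of natural numbers: $\mathtt{singleton}\ x::\{x\}$; $\mathtt{insert}\ x\ s_1::D_1\cup\{x\}$; $\mathtt{delete}\ x\ s_1::D_1\setminus\{x\}$; $\mathtt{union}\ s_1\ s_2::D_1\cup D_2$; $\mathtt{intersection}\ s_1\ s_2::D_1\cap D_2$; $\mathtt{difference}\ s_1\ s_2::D_1\setminus D_2$; $\mathtt{filter}\ f\ s_1::\{x\in D_1\mid f\,x=\mathtt{true}\}$;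 $\mathtt{fromList}\ xs::\{x\mid x\text{ occurs in }xs\}$. 7. If $\mathrm{WF}\,s$, then $\mathtt{foldr}\ f\ n\ s=\mathtt{List.foldr}\ f\ n\ (\mathtt{toList}\ s)$ and $\mathtt{foldl}\ g\ n\ s=\mathtt{List.foldl}\ g\ n\ (\mathtt{toList}\ s)$, for every type $\beta$, every $n\in\beta$ and all functions $f:\mathbb N\to\beta\to\beta$, $g:\beta\to\mathbb N\to\beta$. 8. If $s_1::r_1::D_1$ and $s_2::r_2::D_2$, then $\mathtt{union}\ s_1\ s_2::r_1\sqcup r_2::D_1\cup D_2$ and $\mathtt{intersection}\ s_1\ s_2::_0r_1::D_1\cap D_2$. -/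

import Mathlib

/-!
Big-endian Patricia trees with bitmap leaves, as in Haskell's `Data.IntSet` (containers 0.5.11.0),
over unbounded natural numbers.

The parameter `k` fixes the width `w = 2 ^ k` of the bitmaps (`k = 6` gives 64-bit words).
Bitmaps are natural numbers below `2 ^ w`; an expression `x .&. complement y` of the Haskell code
is written `x ^^^ (x &&& y)`, because natural numbers have no complement.
-/

namespace Patricia

/-- `Bin p m l r`, `Tip p bm` and `Nil`. -/
inductive IntSet : Type
  | Bin : ℕ → ℕ → IntSet → IntSet → IntSet
  | Tip : ℕ → ℕ → IntSet
  | Nil : IntSet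

open IntSet

/-! ### Bit-level operations -/

/-- The width `w` of a bitmap. -/
def width (k : ℕ) : ℕ := 2 ^ k

def suffixBitMask (k : ℕ) : ℕ := width k - 1

/-- `x` with its lower `k = log₂ w` bits cleared. -/
def prefixOf (k x : ℕ) : ℕ := x ^^^ (x &&& suffixBitMask k)

/-- The lower `k = log₂ w` bits of `x`. -/
def suffixOf (k x : ℕ) : ℕ := x &&& suffixBitMask k

def bitmapOfSuffix (s : ℕ) : ℕ := 1 <<< s

def bitmapOf (k x : ℕ) : ℕ := bitmapOfSuffix (suffixOf k x)

/-- Is the mask bit `m` clear in `i`? -/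
def zero (i m : ℕ) : Bool := (i &&& m) == 0

/-- `i` with the mask bit `m` and all lower bits cleared
(in Haskell `i .&. (complement (m-1) xor m)`). -/
def mask (i m : ℕ) : ℕ := i ^^^ (i &&& ((m - 1) ^^^ m))

def noMatch (i p m : ℕ) : Bool := mask i m != p

def isMatch (i p m : ℕ) : Bool := mask i m == p

def shorter (m₁ m₂ : ℕ) : Bool := decide (m₁ > m₂)

def highestBitMask (x : ℕ) : ℕ := 2 ^ Nat.log2 x

/-- The highest bit in which `p₁` and `p₂` differ. -/
def branchMask (p₁ p₂ : ℕ) : ℕ := highestBitMask (p₁ ^^^ p₂)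

/-- The lowest bit set in `x`: 2 to the number of trailing zeros. -/
def lowestBitMask (x : ℕ) : ℕ := 2 ^ padicValNat 2 x

def indexOfTheOnlyBit (x : ℕ) : ℕ := Nat.log2 x

/-- The number of bits set in `x`. -/
def popCount (x : ℕ) : ℕ := ((Finset.range x.size).filter (fun i => x.testBit i = true)).card

def bitcount (a x : ℕ) : ℕ := a + popCount x

/-- The `w`-bit word whose bit `j` is set iff bit `i` of `j` is clear; for `k = 6` these are
`0x5555555555555555`, `0x3333333333333333`, `0x0F0F0F0F0F0F0F0F`, … -/
def swapMask (k i : ℕ) : ℕ := Nat.ofBits (fun j : Fin (width k) => !(j : ℕ).testBit i)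

/-- Exchange adjacent blocks of `2 ^ i` bits. -/
def swapBlocks (k i x : ℕ) : ℕ :=
  ((x >>> (2 ^ i)) &&& swapMask k i) ||| ((x &&& swapMask k i) <<< (2 ^ i))

def revNatSteps (k : ℕ) : ℕ → ℕ → ℕ
  | 0, x => x
  | i + 1, x => swapBlocks k i (revNatSteps k i x)

/-- Reverse the order of the bits in a `w`-bit word, exchanging blocks of 1, 2, 4, …, `w / 2` bits. -/
def revNat (k x : ℕ) : ℕ := revNatSteps k k x

theorem xor_lowestBitMask_lt {bm : ℕ} (h : bm ≠ 0) : bm ^^^ lowestBitMask bm < bm := by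
  have hv : bm.testBit (padicValNat 2 bm) = true := by
    have hnd := pow_succ_padicValNat_not_dvd (p := 2) h
    obtain ⟨c, hc⟩ : 2 ^ padicValNat 2 bm ∣ bm := pow_padicValNat_dvd
    rw [Nat.testBit_eq_decide_div_mod_eq, decide_eq_true_eq]
    have hdiv : bm / 2 ^ padicValNat 2 bm = c := by
      exact Nat.div_eq_of_eq_mul_right (by positivity) hc
    rw [hdiv]
    by_contra hne
    obtain ⟨d, hd⟩ : 2 ∣ c := by omega
    exact hnd ⟨d, by rw [pow_succ, mul_assoc, ← hd]; exact hc⟩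
  refine Nat.lt_of_testBit (padicValNat 2 bm) ?_ hv ?_
  · simp [lowestBitMask, Nat.testBit_xor, hv, Nat.testBit_two_pow_self]
  · intro j hj
    simp [lowestBitMask, Nat.testBit_xor, Nat.testBit_two_pow_of_ne (Nat.ne_of_lt hj)]

def foldlBitsGo {β : Type*} (pre : ℕ) (f : β → ℕ → β) (bm : ℕ) (acc : β) : β :=
  if h : bm = 0 then acc
  else
    foldlBitsGo pre f (bm ^^^ lowestBitMask bm)
      (f acc (pre + indexOfTheOnlyBit (lowestBitMask bm)))
termination_by bm
decreasing_by exact xor_lowestBitMask_lt h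

/-- Left fold over `pre + i` for the bits `i` set in `bitmap`. -/
def foldlBits {β : Type*} (pre : ℕ) (f : β → ℕ → β) (z : β) (bitmap : ℕ) : β :=
  foldlBitsGo pre f bitmap z

def foldrBitsGo {β : Type*} (k pre : ℕ) (f : ℕ → β → β) (bm : ℕ) (acc : β) : β :=
  if h : bm = 0 then acc
  else
    foldrBitsGo k pre f (bm ^^^ lowestBitMask bm)
      (f (pre + (width k - 1) - indexOfTheOnlyBit (lowestBitMask bm)) acc)
termination_by bm
decreasing_by exact xor_lowestBitMask_lt h

/-- Right fold over `pre + i` for the bits `i` set in `bitmap`, by way of the reversed bitmap. -/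
def foldrBits {β : Type*} (k pre : ℕ) (f : ℕ → β → β) (z : β) (bitmap : ℕ) : β :=
  foldrBitsGo k pre f (revNat k bitmap) z

/-! ### Smart constructors -/

def link (p₁ : ℕ) (t₁ : IntSet) (p₂ : ℕ) (t₂ : IntSet) : IntSet :=
  let m := branchMask p₁ p₂
  let p := mask p₁ m
  if zero p₁ m then Bin p m t₁ t₂ else Bin p m t₂ t₁

def bin : ℕ → ℕ → IntSet → IntSet → IntSet
  | _, _, l, Nil => l
  | _, _, Nil, r => r
  | p, m, l, r => Bin p m l r

def tip (kx bm : ℕ) : IntSet := if bm = 0 then Nil else Tip kx bm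

/-! ### Queries -/

def member (k x : ℕ) : IntSet → Bool
  | Bin p m l r =>
      if noMatch x p m then false
      else if zero x m then member k x l
      else member k x r
  | Tip p bm => prefixOf k x == p && (bitmapOf k x &&& bm) != 0
  | Nil => false

def null : IntSet → Bool
  | Nil => true
  | _ => false

def sizeGo : ℕ → IntSet → ℕ
  | acc, Bin _ _ l r => sizeGo (sizeGo acc l) r
  | acc, Tip _ bm => acc + bitcount 0 bm
  | acc, Nil => acc

def size (s : IntSet) : ℕ := sizeGo 0 s

def equal : IntSet → IntSet → Bool
  | Bin p₁ m₁ l₁ r₁, Bin p₂ m₂ l₂ r₂ => m₁ == m₂ && p₁ == p₂ && equal l₁ l₂ && equal r₁ r₂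
  | Tip kx₁ bm₁, Tip kx₂ bm₂ => kx₁ == kx₂ && bm₁ == bm₂
  | Nil, Nil => true
  | _, _ => false

def nequal : IntSet → IntSet → Bool
  | Bin p₁ m₁ l₁ r₁, Bin p₂ m₂ l₂ r₂ => m₁ != m₂ || p₁ != p₂ || nequal l₁ l₂ || nequal r₁ r₂
  | Tip kx₁ bm₁, Tip kx₂ bm₂ => kx₁ != kx₂ || bm₁ != bm₂
  | Nil, Nil => false
  | _, _ => true

def isSubsetOf : IntSet → IntSet → Bool
  | Bin p₁ m₁ l₁ r₁, Bin p₂ m₂ l₂ r₂ =>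
      if shorter m₁ m₂ then false
      else if shorter m₂ m₁ then
        isMatch p₁ p₂ m₂ &&
          (if zero p₁ m₂ then isSubsetOf (Bin p₁ m₁ l₁ r₁) l₂
           else isSubsetOf (Bin p₁ m₁ l₁ r₁) r₂)
      else p₁ == p₂ && isSubsetOf l₁ l₂ && isSubsetOf r₁ r₂
  | Bin _ _ _ _, _ => false
  | Tip kx₁ bm₁, Tip kx₂ bm₂ => kx₁ == kx₂ && (bm₁ ^^^ (bm₁ &&& bm₂)) == 0
  | Tip kx bm, Bin p m l r =>
      if noMatch kx p m then false
      else if zero kx m then isSubsetOf (Tip kx bm) l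
      else isSubsetOf (Tip kx bm) r
  | Tip _ _, Nil => false
  | Nil, _ => true

/-! ### Folds -/

def foldrGo {β : Type*} (k : ℕ) (f : ℕ → β → β) : β → IntSet → β
  | z, Nil => z
  | z, Tip kx bm => foldrBits k kx f z bm
  | z, Bin _ _ l r => foldrGo k f (foldrGo k f z r) l

/-- The Haskell code treats a negative mask at the root separately; there is none in `ℕ`. -/
def foldr {β : Type*} (k : ℕ) (f : ℕ → β → β) (z : β) (s : IntSet) : β := foldrGo k f z s

def foldlGo {β : Type*} (f : β → ℕ → β) : β → IntSet → β
  | z, Nil => z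
  | z, Tip kx bm => foldlBits kx f z bm
  | z, Bin _ _ l r => foldlGo f (foldlGo f z l) r

def foldl {β : Type*} (f : β → ℕ → β) (z : β) (s : IntSet) : β := foldlGo f z s

def toList (k : ℕ) (s : IntSet) : List ℕ := foldr k (fun x xs => x :: xs) [] s

/-! ### Set-returning operations -/

def singleton (k x : ℕ) : IntSet := Tip (prefixOf k x) (bitmapOf k x)

def insertBM (kx bm : ℕ) : IntSet → IntSet
  | Bin p m l r =>
      if noMatch kx p m then link kx (Tip kx bm) p (Bin p m l r)
      else if zero kx m then Bin p m (insertBM kx bm l) r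
      else Bin p m l (insertBM kx bm r)
  | Tip kx' bm' =>
      if kx' = kx then Tip kx' (bm ||| bm')
      else link kx (Tip kx bm) kx' (Tip kx' bm')
  | Nil => Tip kx bm

def insert (k x : ℕ) (s : IntSet) : IntSet := insertBM (prefixOf k x) (bitmapOf k x) s

def deleteBM (kx bm : ℕ) : IntSet → IntSet
  | Bin p m l r =>
      if noMatch kx p m then Bin p m l r
      else if zero kx m then bin p m (deleteBM kx bm l) r
      else bin p m l (deleteBM kx bm r)
  | Tip kx' bm' =>
      if kx' = kx then tip kx (bm' ^^^ (bm' &&& bm))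
      else Tip kx' bm'
  | Nil => Nil

def delete (k x : ℕ) (s : IntSet) : IntSet := deleteBM (prefixOf k x) (bitmapOf k x) s

def union : IntSet → IntSet → IntSet
  | Bin p₁ m₁ l₁ r₁, Bin p₂ m₂ l₂ r₂ =>
      if shorter m₁ m₂ then
        if noMatch p₂ p₁ m₁ then link p₁ (Bin p₁ m₁ l₁ r₁) p₂ (Bin p₂ m₂ l₂ r₂)
        else if zero p₂ m₁ then Bin p₁ m₁ (union l₁ (Bin p₂ m₂ l₂ r₂)) r₁
        else Bin p₁ m₁ l₁ (union r₁ (Bin p₂ m₂ l₂ r₂))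
      else if shorter m₂ m₁ then
        if noMatch p₁ p₂ m₂ then link p₁ (Bin p₁ m₁ l₁ r₁) p₂ (Bin p₂ m₂ l₂ r₂)
        else if zero p₁ m₂ then Bin p₂ m₂ (union (Bin p₁ m₁ l₁ r₁) l₂) r₂
        else Bin p₂ m₂ l₂ (union (Bin p₁ m₁ l₁ r₁) r₂)
      else if p₁ = p₂ then Bin p₁ m₁ (union l₁ l₂) (union r₁ r₂)
      else link p₁ (Bin p₁ m₁ l₁ r₁) p₂ (Bin p₂ m₂ l₂ r₂)
  | Bin p m l r, Tip kx bm => insertBM kx bm (Bin p m l r)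
  | Bin p m l r, Nil => Bin p m l r
  | Tip kx bm, t => insertBM kx bm t
  | Nil, t => t
termination_by t₁ t₂ => sizeOf t₁ + sizeOf t₂

/-- `difference (Tip kx bm) t` for the tree `t` given last. -/
def differenceTip (kx bm : ℕ) : IntSet → IntSet
  | Bin p₂ m₂ l₂ r₂ =>
      if noMatch kx p₂ m₂ then Tip kx bm
      else if zero kx m₂ then differenceTip kx bm l₂
      else differenceTip kx bm r₂
  | Tip kx₂ bm₂ => if kx = kx₂ then tip kx (bm ^^^ (bm &&& bm₂)) else Tip kx bm
  | Nil => Tip kx bm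

def difference : IntSet → IntSet → IntSet
  | Bin p₁ m₁ l₁ r₁, Bin p₂ m₂ l₂ r₂ =>
      if shorter m₁ m₂ then
        if noMatch p₂ p₁ m₁ then Bin p₁ m₁ l₁ r₁
        else if zero p₂ m₁ then bin p₁ m₁ (difference l₁ (Bin p₂ m₂ l₂ r₂)) r₁
        else bin p₁ m₁ l₁ (difference r₁ (Bin p₂ m₂ l₂ r₂))
      else if shorter m₂ m₁ then
        if noMatch p₁ p₂ m₂ then Bin p₁ m₁ l₁ r₁
        else if zero p₁ m₂ then difference (Bin p₁ m₁ l₁ r₁) l₂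
        else difference (Bin p₁ m₁ l₁ r₁) r₂
      else if p₁ = p₂ then bin p₁ m₁ (difference l₁ l₂) (difference r₁ r₂)
      else Bin p₁ m₁ l₁ r₁
  | Bin p m l r, Tip kx bm => deleteBM kx bm (Bin p m l r)
  | Bin p m l r, Nil => Bin p m l r
  | Tip kx bm, t => differenceTip kx bm t
  | Nil, _ => Nil
termination_by t₁ t₂ => sizeOf t₁ + sizeOf t₂

/-- The intersection of `Tip kx bm` with the tree given last. -/
def intersectBM (kx bm : ℕ) : IntSet → IntSet
  | Bin p m l r =>
      if noMatch kx p m then Nil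
      else if zero kx m then intersectBM kx bm l
      else intersectBM kx bm r
  | Tip kx' bm' => if kx = kx' then tip kx (bm &&& bm') else Nil
  | Nil => Nil

def intersection : IntSet → IntSet → IntSet
  | Bin p₁ m₁ l₁ r₁, Bin p₂ m₂ l₂ r₂ =>
      if shorter m₁ m₂ then
        if noMatch p₂ p₁ m₁ then Nil
        else if zero p₂ m₁ then intersection l₁ (Bin p₂ m₂ l₂ r₂)
        else intersection r₁ (Bin p₂ m₂ l₂ r₂)
      else if shorter m₂ m₁ then
        if noMatch p₁ p₂ m₂ then Nil
        else if zero p₁ m₂ then intersection (Bin p₁ m₁ l₁ r₁) l₂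
        else intersection (Bin p₁ m₁ l₁ r₁) r₂
      else if p₁ = p₂ then bin p₁ m₁ (intersection l₁ l₂) (intersection r₁ r₂)
      else Nil
  | Bin p m l r, Tip kx bm => intersectBM kx bm (Bin p m l r)
  | Bin _ _ _ _, Nil => Nil
  | Tip kx bm, t => intersectBM kx bm t
  | Nil, _ => Nil
termination_by t₁ t₂ => sizeOf t₁ + sizeOf t₂

def filter (f : ℕ → Bool) : IntSet → IntSet
  | Bin p m l r => bin p m (filter f l) (filter f r)
  | Tip kx bm =>
      tip kx (foldlBits 0 (fun acc bi => if f (kx + bi) then acc ||| bitmapOfSuffix bi else acc)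
        0 bm)
  | Nil => Nil

def fromList (k : ℕ) (xs : List ℕ) : IntSet := xs.foldl (fun t x => insert k x t) Nil

/-! ### Dyadic intervals -/

/-- The dyadic interval `d(p, b) = [p * 2 ^ b, …, (p + 1) * 2 ^ b - 1]`. -/
@[ext]
structure DyadicInterval where
  p : ℕ
  b : ℕ

namespace DyadicInterval

def toSet (r : DyadicInterval) : Set ℕ := {x | r.p * 2 ^ r.b ≤ x ∧ x < (r.p + 1) * 2 ^ r.b}

theorem toSet_injective : Function.Injective toSet := by
  rintro ⟨p, b⟩ ⟨q, c⟩ h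
  have h2 : ∀ n : ℕ, 0 < 2 ^ n := fun n => by positivity
  have hIco : Set.Ico (p * 2 ^ b) ((p + 1) * 2 ^ b) = Set.Ico (q * 2 ^ c) ((q + 1) * 2 ^ c) := h
  have hlt : p * 2 ^ b < (p + 1) * 2 ^ b := Nat.mul_lt_mul_of_pos_right (by omega) (h2 b)
  obtain ⟨e₁, e₂⟩ := (Set.Ico_eq_Ico_iff (Or.inl hlt)).1 hIco
  have e : 2 ^ b = 2 ^ c := by
    rw [add_mul, add_mul, one_mul, one_mul, e₁] at e₂
    omega
  have hbc : b = c := Nat.pow_right_injective le_rfl e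
  subst hbc
  have hpq : p = q := Nat.eq_of_mul_eq_mul_right (h2 b) e₁
  rw [hpq]

/-- Dyadic intervals are ordered by inclusion. -/
instance : PartialOrder DyadicInterval := PartialOrder.lift toSet toSet_injective

/-- The lower half of an interval (meaningful for `0 < r.b`). -/
def lowerHalf (r : DyadicInterval) : DyadicInterval := ⟨2 * r.p, r.b - 1⟩

/-- The upper half of an interval (meaningful for `0 < r.b`). -/
def upperHalf (r : DyadicInterval) : DyadicInterval := ⟨2 * r.p + 1, r.b - 1⟩

end DyadicInterval

/-! ### Well-formedness and denotation -/

/-- `s :: r :: D`: the tree `s` is well-formed and not `Nil`, it lives in the dyadic interval `r`,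
and it denotes the set `D`. -/
inductive Desc (k : ℕ) : IntSet → DyadicInterval → Set ℕ → Prop
  | tip {p p' bm : ℕ} {D : Set ℕ} (hp : p' = p * width k) (hpos : 0 < bm) (hlt : bm < 2 ^ width k)
      (hD : D = {x | ∃ j, bm.testBit j = true ∧ x = p * width k + j}) :
      Desc k (Tip p' bm) ⟨p, k⟩ D
  | bin {s₁ s₂ : IntSet} {r₁ r₂ : DyadicInterval} {D₁ D₂ D : Set ℕ} {p b p' m : ℕ}
      (h₁ : Desc k s₁ r₁ D₁) (h₂ : Desc k s₂ r₂ D₂)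
      (hr₁ : r₁ ≤ DyadicInterval.lowerHalf ⟨p, b⟩) (hr₂ : r₂ ≤ DyadicInterval.upperHalf ⟨p, b⟩)
      (hb : 0 < b) (hp : p' = p * 2 ^ b) (hm : m = 2 ^ (b - 1)) (hD : D = D₁ ∪ D₂) :
      Desc k (Bin p' m s₁ s₂) ⟨p, b⟩ D

/-- `s :: D`: the tree `s` is well-formed and denotes the set `D`. -/
inductive Sem (k : ℕ) : IntSet → Set ℕ → Prop
  | nil : Sem k Nil ∅
  | desc {s : IntSet} {r : DyadicInterval} {D : Set ℕ} (h : Desc k s r D) : Sem k s D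

/-- `s` is well-formed. -/
def WF (k : ℕ) (s : IntSet) : Prop := ∃ D, Sem k s D

/-- `s ::₀ r :: D`: as `Desc`, but `s` may be `Nil`, and `r` may be any larger interval. -/
inductive DescO (k : ℕ) : IntSet → DyadicInterval → Set ℕ → Prop
  | nil (r : DyadicInterval) : DescO k Nil r ∅
  | desc {s : IntSet} {r r' : DyadicInterval} {D : Set ℕ} (h : Desc k s r D) (hr : r ≤ r') :
      DescO k s r' D

end Patricia

/-! The dyadic intervals of height `b` are the fibres of `x ↦ x / 2 ^ b`, and division by a larger
power factors through division by a smaller one. Two intervals with a common point are therefore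
nested according to their heights (`le_of_mem_of_mem`), and one binary digit decides in which half
of an interval a point lies.

The set determines the tree. Both children of a node denote non-empty sets, so the set of the node
meets both halves of its interval, and any dyadic interval around that set contains the whole
interval (`le_of_meets_halves`). Hence the interval of a description is least among those of height
at least `k` (`Desc.le_of_subset`). Intersecting the set with the two halves recovers the sets of
the children, and induction gives `Desc.tree_unique`. Structural equality is thereby equality of
sets.

The operations rest on a geometric reading of their tests. At a node of greater height, `noMatch`
and `zero` report whether a smaller interval is disjoint from the node's interval, in its lower half
or in its upper half (`branch_cases`). Each case then reduces to a set identity for subsets of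
disjoint halves, plus an induction hypothesis. Growing operations keep track of the exact least
upper bound, and `link` realises it because the highest differing bit is where two disjoint
intervals separate (`separate_of_disjoint`, `desc_link`). Shrinking operations may empty a subtree,
so they keep only an enclosing interval, in the form of `DescO` (`descO_bin`).

Folds reduce to the list `elements`, through the increasing list `setBits` of the bits of a word.
The right fold also needs that `revNat` reflects bit positions, which follows from an invariant on
aligned blocks (`testBit_revNatSteps`). -/

namespace Patricia

open IntSet

/-! ### Dyadic intervals: nesting, halves and least upper bounds. -/

namespace DyadicInterval

theorem mem_toSet_iff {r : DyadicInterval} {x : ℕ} : x ∈ r.toSet ↔ x / 2 ^ r.b = r.p := by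
  have h : 0 < 2 ^ r.b := by positivity
  rw [Nat.div_eq_iff h]
  simp only [toSet, Set.mem_ofPred_eq, add_mul, one_mul]
  omega

theorem base_mem (r : DyadicInterval) : r.p * 2 ^ r.b ∈ r.toSet := by
  rw [mem_toSet_iff, Nat.mul_div_cancel _ (by positivity)]

theorem toSet_nonempty (r : DyadicInterval) : r.toSet.Nonempty := ⟨_, r.base_mem⟩

theorem div_two_pow_eq_of_le {x y b c : ℕ} (hbc : b ≤ c) (h : x / 2 ^ b = y / 2 ^ b) :
    x / 2 ^ c = y / 2 ^ c := by
  obtain ⟨d, rfl⟩ := Nat.exists_eq_add_of_le hbc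
  rw [pow_add, ← Nat.div_div_eq_div_mul, h, Nat.div_div_eq_div_mul]

theorem le_of_mem_of_mem {r₁ r₂ : DyadicInterval} {x : ℕ} (h₁ : x ∈ r₁.toSet)
    (h₂ : x ∈ r₂.toSet) (hb : r₁.b ≤ r₂.b) : r₁ ≤ r₂ := by
  intro y hy
  rw [mem_toSet_iff] at *
  rw [← h₂]
  exact div_two_pow_eq_of_le hb (hy.trans h₁.symm)

/-- A strictly higher `r₁` would contain `r₂` as well, since they share a point. The two would then
be equal, against the difference in height. -/
theorem b_le_of_le {r₁ r₂ : DyadicInterval} (h : r₁ ≤ r₂) : r₁.b ≤ r₂.b := by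
  by_contra! hlt
  have h' : r₂ ≤ r₁ := le_of_mem_of_mem (h r₁.base_mem) r₁.base_mem hlt.le
  exact absurd (congrArg DyadicInterval.b (le_antisymm h h')) hlt.ne'

theorem eq_of_le_of_b_eq {r₁ r₂ : DyadicInterval} (h : r₁ ≤ r₂) (hb : r₁.b = r₂.b) : r₁ = r₂ :=
  le_antisymm h (le_of_mem_of_mem (h r₁.base_mem) r₁.base_mem hb.ge)

theorem disjoint_or_le_of_b_le {r₁ r₂ : DyadicInterval} (hb : r₁.b ≤ r₂.b) :
    Disjoint r₁.toSet r₂.toSet ∨ r₁ ≤ r₂ := by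
  by_cases h : Disjoint r₁.toSet r₂.toSet
  · exact Or.inl h
  · obtain ⟨x, h₁, h₂⟩ := Set.not_disjoint_iff.1 h
    exact Or.inr (le_of_mem_of_mem h₁ h₂ hb)

theorem disjoint_or_le_or_le (r₁ r₂ : DyadicInterval) :
    Disjoint r₁.toSet r₂.toSet ∨ r₁ ≤ r₂ ∨ r₂ ≤ r₁ := by
  rcases le_total r₁.b r₂.b with h | h
  · rcases disjoint_or_le_of_b_le h with h | h
    exacts [Or.inl h, Or.inr (Or.inl h)]
  · rcases disjoint_or_le_of_b_le h with h | h
    exacts [Or.inl h.symm, Or.inr (Or.inr h)]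

/-- Bit `c` of `x` is the last binary digit of `x / 2 ^ c`. This is what lets a single bit choose
between the two halves. -/
theorem testBit_div {x c : ℕ} : x / 2 ^ c = 2 * (x / 2 ^ (c + 1)) + (x.testBit c).toNat := by
  rw [pow_succ, ← Nat.div_div_eq_div_mul, Nat.toNat_testBit]
  omega

theorem mem_lowerHalf_iff {r : DyadicInterval} (hr : 0 < r.b) {x : ℕ} :
    x ∈ r.lowerHalf.toSet ↔ x ∈ r.toSet ∧ x.testBit (r.b - 1) = false := by
  obtain ⟨p, b⟩ := r
  obtain ⟨c, rfl⟩ : ∃ c, b = c + 1 := ⟨b - 1, by simp at hr; omega⟩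
  simp only [mem_toSet_iff, lowerHalf, Nat.add_sub_cancel]
  rw [testBit_div]
  cases x.testBit c
  · simp
  · simp
    omega

theorem mem_upperHalf_iff {r : DyadicInterval} (hr : 0 < r.b) {x : ℕ} :
    x ∈ r.upperHalf.toSet ↔ x ∈ r.toSet ∧ x.testBit (r.b - 1) = true := by
  obtain ⟨p, b⟩ := r
  obtain ⟨c, rfl⟩ : ∃ c, b = c + 1 := ⟨b - 1, by simp at hr; omega⟩
  simp only [mem_toSet_iff, upperHalf, Nat.add_sub_cancel]
  rw [testBit_div]
  cases x.testBit c
  · simp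
    omega
  · simp

theorem lowerHalf_le {r : DyadicInterval} (hr : 0 < r.b) : r.lowerHalf ≤ r :=
  fun _ hx => ((mem_lowerHalf_iff hr).1 hx).1

theorem upperHalf_le {r : DyadicInterval} (hr : 0 < r.b) : r.upperHalf ≤ r :=
  fun _ hx => ((mem_upperHalf_iff hr).1 hx).1

theorem disjoint_halves {r : DyadicInterval} (hr : 0 < r.b) :
    Disjoint r.lowerHalf.toSet r.upperHalf.toSet := by
  rw [Set.disjoint_left]
  intro x h₁ h₂
  have := ((mem_lowerHalf_iff hr).1 h₁).2
  simp [((mem_upperHalf_iff hr).1 h₂).2] at this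

theorem union_halves {r : DyadicInterval} (hr : 0 < r.b) :
    r.lowerHalf.toSet ∪ r.upperHalf.toSet = r.toSet := by
  ext x
  rw [Set.mem_union, mem_lowerHalf_iff hr, mem_upperHalf_iff hr]
  cases x.testBit (r.b - 1) <;> simp

/-- If `r'` were lower than `r`, it would fit inside the lower half, which it meets, and so miss the
upper half. -/
theorem le_of_meets_halves {r r' : DyadicInterval} (hr : 0 < r.b)
    (h₁ : (r'.toSet ∩ r.lowerHalf.toSet).Nonempty)
    (h₂ : (r'.toSet ∩ r.upperHalf.toSet).Nonempty) : r ≤ r' := by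
  obtain ⟨x, hx, hx₁⟩ := h₁
  obtain ⟨y, hy, hy₂⟩ := h₂
  refine le_of_mem_of_mem (lowerHalf_le hr hx₁) hx ?_
  by_contra! hlt
  have hle : r' ≤ r.lowerHalf := le_of_mem_of_mem hx hx₁ (by simp [lowerHalf]; omega)
  exact Set.disjoint_left.1 (disjoint_halves hr) (hle hy) hy₂

theorem isLUB_of_halves {r r₁ r₂ : DyadicInterval} (hr : 0 < r.b) (h₁ : r₁ ≤ r.lowerHalf)
    (h₂ : r₂ ≤ r.upperHalf) : IsLUB {r₁, r₂} r := by
  constructor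
  · rintro _ (rfl | rfl)
    exacts [h₁.trans (lowerHalf_le hr), h₂.trans (upperHalf_le hr)]
  · intro r' h'
    exact le_of_meets_halves hr ⟨_, h' (by simp) r₁.base_mem, h₁ r₁.base_mem⟩
      ⟨_, h' (by simp) r₂.base_mem, h₂ r₂.base_mem⟩

theorem isLUB_of_le {r₁ r₂ : DyadicInterval} (h : r₁ ≤ r₂) : IsLUB {r₁, r₂} r₂ := by
  constructor
  · rintro _ (rfl | rfl)
    exacts [h, le_rfl]
  · exact fun r' h' => h' (by simp)

theorem isLUB_of_ge {r₁ r₂ : DyadicInterval} (h : r₂ ≤ r₁) : IsLUB {r₁, r₂} r₁ := by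
  rw [Set.pair_comm]
  exact isLUB_of_le h

/-- The height at which two distinct points separate is the highest bit in which they differ. -/
theorem div_eq_and_testBit_ne_of_ne {x y : ℕ} (h : x ≠ y) :
    x / 2 ^ (Nat.log2 (x ^^^ y) + 1) = y / 2 ^ (Nat.log2 (x ^^^ y) + 1) ∧
      x.testBit (Nat.log2 (x ^^^ y)) ≠ y.testBit (Nat.log2 (x ^^^ y)) := by
  have h0 : x ^^^ y ≠ 0 := by simpa [Nat.xor_eq_zero_iff] using h
  constructor
  · have : (x ^^^ y) >>> (Nat.log2 (x ^^^ y) + 1) = 0 := by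
      rw [Nat.shiftRight_eq_div_pow]
      exact Nat.div_eq_of_lt Nat.lt_log2_self
    rw [Nat.shiftRight_xor_distrib, Nat.xor_eq_zero_iff] at this
    simpa [Nat.shiftRight_eq_div_pow] using this
  · have := Nat.testBit_log2 h0
    rw [Nat.testBit_xor] at this
    simpa using this

/-- Disjoint intervals lie in different halves of the interval at which they separate. -/
theorem separate_of_disjoint {r₁ r₂ : DyadicInterval} (h : Disjoint r₁.toSet r₂.toSet) {x y : ℕ}
    (hx : x ∈ r₁.toSet) (hy : y ∈ r₂.toSet) {c : ℕ} (hc : c = Nat.log2 (x ^^^ y))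
    {r : DyadicInterval} (hr : r = ⟨x / 2 ^ (c + 1), c + 1⟩) :
    (x.testBit c = false ∧ r₁ ≤ r.lowerHalf ∧ r₂ ≤ r.upperHalf) ∨
      (x.testBit c = true ∧ r₂ ≤ r.lowerHalf ∧ r₁ ≤ r.upperHalf) := by
  have hxy : x ≠ y := by
    rintro rfl
    exact Set.disjoint_left.1 h hx hy
  obtain ⟨hd, ht⟩ := div_eq_and_testBit_ne_of_ne hxy
  rw [← hc] at hd ht
  have hpos : 0 < r.b := by simp [hr]
  have hrb : r.b - 1 = c := by simp [hr]
  have hxr : x ∈ r.toSet := by rw [mem_toSet_iff, hr]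
  have hyr : y ∈ r.toSet := by rw [mem_toSet_iff, hr, hd]
  -- The points `x` and `y` agree above bit `c`, so an interval of height greater than `c` around
  -- one also contains the other.
  have h₁ : r₁.b ≤ c := by
    by_contra! hlt
    rw [mem_toSet_iff] at hx
    exact Set.disjoint_left.1 h
      (mem_toSet_iff.2 ((div_two_pow_eq_of_le hlt hd).symm.trans hx)) hy
  have h₂ : r₂.b ≤ c := by
    by_contra! hlt
    rw [mem_toSet_iff] at hy
    exact Set.disjoint_left.1 h hx
      (mem_toSet_iff.2 ((div_two_pow_eq_of_le hlt hd).trans hy))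
  have hl : r.lowerHalf.b = c := by simp [lowerHalf, hr]
  have hu : r.upperHalf.b = c := by simp [upperHalf, hr]
  cases hxt : x.testBit c
  · have hyt : y.testBit c = true := by simpa [hxt] using ht
    refine Or.inl ⟨rfl, le_of_mem_of_mem hx ((mem_lowerHalf_iff hpos).2 ⟨hxr, hrb ▸ hxt⟩) ?_,
      le_of_mem_of_mem hy ((mem_upperHalf_iff hpos).2 ⟨hyr, hrb ▸ hyt⟩) ?_⟩ <;> omega
  · have hyt : y.testBit c = false := by simpa [hxt] using ht
    refine Or.inr ⟨rfl, le_of_mem_of_mem hy ((mem_lowerHalf_iff hpos).2 ⟨hyr, hrb ▸ hyt⟩) ?_,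
      le_of_mem_of_mem hx ((mem_upperHalf_iff hpos).2 ⟨hxr, hrb ▸ hxt⟩) ?_⟩ <;> omega

theorem exists_isLUB (r₁ r₂ : DyadicInterval) : ∃ r, IsLUB {r₁, r₂} r := by
  rcases disjoint_or_le_or_le r₁ r₂ with h | h | h
  · rcases separate_of_disjoint h r₁.base_mem r₂.base_mem rfl rfl with ⟨-, h₁, h₂⟩ | ⟨-, h₂, h₁⟩
    · exact ⟨_, isLUB_of_halves (Nat.succ_pos _) h₁ h₂⟩
    · rw [Set.pair_comm]
      exact ⟨_, isLUB_of_halves (Nat.succ_pos _) h₂ h₁⟩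
  · exact ⟨_, isLUB_of_le h⟩
  · exact ⟨_, isLUB_of_ge h⟩

end DyadicInterval

/-! ### Bit-level operations -/

theorem width_pos (k : ℕ) : 0 < width k := by simp [width]

theorem xor_and_two_pow_sub_one (x b : ℕ) : x ^^^ (x &&& (2 ^ b - 1)) = x / 2 ^ b * 2 ^ b := by
  apply Nat.eq_of_testBit_eq
  intro i
  simp only [Nat.testBit_xor, Nat.testBit_and, Nat.testBit_two_pow_sub_one, Nat.testBit_mul_two_pow,
    Nat.testBit_div_two_pow]
  by_cases h : i < b
  · simp [h]
  · have h' : b ≤ i := not_lt.1 h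
    simp [h, h']

/-- For a power of two `m`, the word `(m - 1) ^^^ m` has ones exactly at the bit of `m` and below
it. -/
theorem mask_two_pow {b : ℕ} (hb : 0 < b) (x : ℕ) :
    mask x (2 ^ (b - 1)) = x / 2 ^ b * 2 ^ b := by
  obtain ⟨c, rfl⟩ : ∃ c, b = c + 1 := ⟨b - 1, by omega⟩
  have : (2 ^ c - 1) ^^^ 2 ^ c = 2 ^ (c + 1) - 1 := by
    apply Nat.eq_of_testBit_eq
    intro i
    simp only [Nat.testBit_xor, Nat.testBit_two_pow_sub_one, Nat.testBit_two_pow]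
    rcases lt_trichotomy i c with h | h | h
    · have h1 : c ≠ i := by omega
      have h2 : i < c + 1 := by omega
      simp [h, h1, h2]
    · simp [h]
    · have h1 : c ≠ i := by omega
      have h2 : ¬ i < c + 1 := by omega
      have h3 : ¬ i < c := by omega
      simp [h1, h2, h3]
  rw [mask, Nat.add_sub_cancel, this, xor_and_two_pow_sub_one]

theorem prefixOf_eq (k x : ℕ) : prefixOf k x = x / 2 ^ k * width k :=
  xor_and_two_pow_sub_one x k

theorem suffixOf_eq (k x : ℕ) : suffixOf k x = x % 2 ^ k :=
  Nat.and_two_pow_sub_one_eq_mod x k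

theorem bitmapOf_eq (k x : ℕ) : bitmapOf k x = 2 ^ (x % 2 ^ k) := by
  simp [bitmapOf, bitmapOfSuffix, suffixOf_eq, Nat.one_shiftLeft]

theorem zero_two_pow (x c : ℕ) : zero x (2 ^ c) = !x.testBit c := by
  rw [zero, Nat.and_two_pow]
  cases x.testBit c <;> simp

theorem isMatch_eq_not_noMatch (i p m : ℕ) : isMatch i p m = !noMatch i p m := by
  simp [isMatch, noMatch, bne]

theorem shorter_two_pow {b c : ℕ} (hb : 0 < b) (hc : 0 < c) :
    shorter (2 ^ (b - 1)) (2 ^ (c - 1)) = decide (c < b) := by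
  simp only [shorter, gt_iff_lt, Nat.pow_lt_pow_iff_right one_lt_two]
  congr 1
  simp
  omega

theorem noMatch_two_pow {p b : ℕ} (hb : 0 < b) (x : ℕ) :
    noMatch x (p * 2 ^ b) (2 ^ (b - 1)) = true ↔ x ∉ (DyadicInterval.mk p b).toSet := by
  rw [noMatch, mask_two_pow hb, DyadicInterval.mem_toSet_iff, bne_iff_ne, ne_eq, not_iff_not]
  exact Nat.mul_left_inj (by positivity)

open DyadicInterval in
/-- How the tests at a node relate a shorter interval to the interval of the node. -/
theorem branch_cases {r₁ : DyadicInterval} {p b : ℕ} (hlt : r₁.b < b) {x : ℕ}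
    (hx : x ∈ r₁.toSet) :
    (noMatch x (p * 2 ^ b) (2 ^ (b - 1)) = true ∧ Disjoint r₁.toSet (mk p b).toSet) ∨
    (noMatch x (p * 2 ^ b) (2 ^ (b - 1)) = false ∧ zero x (2 ^ (b - 1)) = true ∧
      r₁ ≤ (mk p b).lowerHalf) ∨
    (noMatch x (p * 2 ^ b) (2 ^ (b - 1)) = false ∧ zero x (2 ^ (b - 1)) = false ∧
      r₁ ≤ (mk p b).upperHalf) := by
  have hb : 0 < b := by omega
  rw [zero_two_pow]
  cases h : noMatch x (p * 2 ^ b) (2 ^ (b - 1))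
  · have hxr : x ∈ (mk p b).toSet := by
      by_contra hn
      rw [(noMatch_two_pow hb x).2 hn] at h
      exact absurd h (by simp)
    refine Or.inr ?_
    cases ht : x.testBit (b - 1)
    · refine Or.inl ⟨rfl, rfl, le_of_mem_of_mem hx ((mem_lowerHalf_iff hb).2 ⟨hxr, ht⟩) ?_⟩
      simp [lowerHalf]
      omega
    · refine Or.inr ⟨rfl, rfl, le_of_mem_of_mem hx ((mem_upperHalf_iff hb).2 ⟨hxr, ht⟩) ?_⟩
      simp [upperHalf]
      omega
  · refine Or.inl ⟨rfl, ?_⟩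
    rcases disjoint_or_le_of_b_le (r₁ := r₁) (r₂ := mk p b) hlt.le with h' | h'
    · exact h'
    · exact absurd (h' hx) ((noMatch_two_pow hb x).1 h)

end Patricia

namespace Patricia

open IntSet DyadicInterval

variable {k : ℕ} {s s₁ s₂ : IntSet} {r r₁ r₂ : DyadicInterval} {D D₁ D₂ : Set ℕ}

/-! ### Descriptions -/

/-- The bound on `bm` forces `j < 2 ^ k`, so `p` and `j` are the quotient and the remainder of `x`.
-/
theorem mem_tip_iff {p bm : ℕ} (hlt : bm < 2 ^ width k) (x : ℕ) :
    (∃ j, bm.testBit j = true ∧ x = p * width k + j) ↔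
      x / 2 ^ k = p ∧ bm.testBit (x % 2 ^ k) = true := by
  constructor
  · rintro ⟨j, hj, rfl⟩
    have hjw : j < 2 ^ k := by
      by_contra! hn
      have := Nat.testBit_lt_two_pow
        (hlt.trans_le (Nat.pow_le_pow_right (by norm_num) (show width k ≤ j from hn)))
      simp [this] at hj
    have hw : 0 < 2 ^ k := by positivity
    simp only [width]
    rw [mul_comm, Nat.mul_add_div hw, Nat.mul_add_mod, Nat.div_eq_of_lt hjw, Nat.mod_eq_of_lt hjw]
    exact ⟨rfl, hj⟩
  · rintro ⟨rfl, hj⟩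
    exact ⟨_, hj, (Nat.div_add_mod' x (2 ^ k)).symm⟩

theorem Desc.of_tip {p bm : ℕ} (hpos : 0 < bm) (hlt : bm < 2 ^ width k)
    (hD : ∀ x, x ∈ D ↔ x / 2 ^ k = p ∧ bm.testBit (x % 2 ^ k) = true) :
    Desc k (Tip (p * width k) bm) ⟨p, k⟩ D :=
  .tip rfl hpos hlt (Set.ext fun x => (hD x).trans (mem_tip_iff hlt x).symm)

theorem Desc.tip_inv {kx bm : ℕ} (h : Desc k (Tip kx bm) r D) :
    r.b = k ∧ kx = r.p * width k ∧ 0 < bm ∧ bm < 2 ^ width k ∧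
      ∀ x, x ∈ D ↔ x / 2 ^ k = r.p ∧ bm.testBit (x % 2 ^ k) = true := by
  cases h with
  | tip hp hpos hlt hD =>
    subst hD
    exact ⟨rfl, hp, hpos, hlt, mem_tip_iff hlt⟩

theorem Desc.key_mem {kx bm : ℕ} (h : Desc k (Tip kx bm) r D) : kx ∈ r.toSet := by
  cases h with
  | tip hp hpos hlt hD =>
    subst hp
    exact base_mem ⟨_, k⟩

theorem Desc.le_b (h : Desc k s r D) : k ≤ r.b := by
  induction h with
  | tip => exact le_rfl
  | bin h₁ h₂ hr₁ hr₂ hb hp hm hD ih₁ ih₂ =>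
    refine ih₁.trans ((b_le_of_le hr₁).trans ?_)
    simp [lowerHalf]

theorem Desc.lt_b_of_bin {p m : ℕ} (h : Desc k (Bin p m s₁ s₂) r D) : k < r.b := by
  cases h with
  | bin h₁ h₂ hr₁ hr₂ hb hp hm hD =>
    have := h₁.le_b.trans (b_le_of_le hr₁)
    simp only [lowerHalf] at this ⊢
    omega

theorem Desc.subset (h : Desc k s r D) : D ⊆ r.toSet := by
  induction h with
  | tip hp hpos hlt hD =>
    subst hD
    intro x hx
    exact mem_toSet_iff.2 ((mem_tip_iff hlt x).1 hx).1
  | bin h₁ h₂ hr₁ hr₂ hb hp hm hD ih₁ ih₂ =>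
    subst hD
    exact Set.union_subset (ih₁.trans (hr₁.trans (lowerHalf_le hb)))
      (ih₂.trans (hr₂.trans (upperHalf_le hb)))

theorem Desc.nonempty (h : Desc k s r D) : D.Nonempty := by
  induction h with
  | tip hp hpos hlt hD =>
    subst hD
    obtain ⟨j, hj⟩ := Nat.exists_testBit_of_ne_zero hpos.ne'
    exact ⟨_, j, hj, rfl⟩
  | bin h₁ h₂ hr₁ hr₂ hb hp hm hD ih₁ ih₂ =>
    subst hD
    exact ih₁.inl

/-- A leaf already has the least height allowed, so one common point suffices. For a node, the
children supply a point in each half. -/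
theorem Desc.le_of_subset (h : Desc k s r D) {r' : DyadicInterval} (hb : k ≤ r'.b)
    (hD : D ⊆ r'.toSet) : r ≤ r' := by
  cases h with
  | tip hp hpos hlt hD' =>
    -- The case split took the description apart; it is reassembled so that the lemmas on
    -- descriptions apply to it.
    have h := Desc.tip hp hpos hlt hD'
    obtain ⟨x, hx⟩ := h.nonempty
    exact le_of_mem_of_mem (h.subset hx) (hD hx) hb
  | bin h₁ h₂ hr₁ hr₂ hb hp hm hD' =>
    subst hD'
    obtain ⟨x, hx⟩ := h₁.nonempty
    obtain ⟨y, hy⟩ := h₂.nonempty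
    exact le_of_meets_halves hb ⟨x, hD (Or.inl hx), hr₁ (h₁.subset hx)⟩
      ⟨y, hD (Or.inr hy), hr₂ (h₂.subset hy)⟩

theorem Desc.interval_unique (h₁ : Desc k s₁ r₁ D) (h₂ : Desc k s₂ r₂ D) : r₁ = r₂ :=
  le_antisymm (h₁.le_of_subset h₂.le_b h₂.subset) (h₂.le_of_subset h₁.le_b h₁.subset)

theorem union_inter_left_of_subset {A B U V : Set ℕ} (hA : A ⊆ U) (hB : B ⊆ V)
    (h : Disjoint U V) : (A ∪ B) ∩ U = A := by
  ext x
  have := @hA x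
  have := @hB x
  have : x ∈ U → x ∉ V := fun hx => Set.disjoint_left.1 h hx
  simp only [Set.mem_inter_iff, Set.mem_union]
  tauto

theorem union_inter_right_of_subset {A B U V : Set ℕ} (hA : A ⊆ U) (hB : B ⊆ V)
    (h : Disjoint U V) : (A ∪ B) ∩ V = B := by
  rw [Set.union_comm]
  exact union_inter_left_of_subset hB hA h.symm

/-- The set fixes the interval, hence the prefix and the mask. Cutting the set along the halves then
fixes the sets of the children. -/
theorem Desc.tree_unique (h₁ : Desc k s₁ r₁ D) (h₂ : Desc k s₂ r₂ D) : s₁ = s₂ := by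
  induction h₁ generalizing s₂ r₂ with
  | @tip p _ _ _ hp hpos hlt hD =>
    have h₁ := Desc.tip hp hpos hlt hD
    have hr := h₁.interval_unique h₂
    subst hr
    cases h₂ with
    | tip hp' hpos' hlt' hD' =>
      subst hp hp'
      congr 1
      apply Nat.eq_of_testBit_eq
      intro j
      have := Set.ext_iff.1 (hD.symm.trans hD') (p * width k + j)
      simpa using this
    | bin g₁ g₂ hr₁ hr₂ hb hp' hm hD' =>
      -- The interval of a leaf has height exactly `k`, while that of a node is strictly higher.
      exact absurd (Desc.bin g₁ g₂ hr₁ hr₂ hb hp' hm hD').lt_b_of_bin (lt_irrefl _)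
  | @bin a₁ a₂ q₁ q₂ E₁ E₂ E p b p' m g₁ g₂ hr₁ hr₂ hb hp hm hD ih₁ ih₂ =>
    have h₁ := Desc.bin g₁ g₂ hr₁ hr₂ hb hp hm hD
    have hr := h₁.interval_unique h₂
    subst hr
    cases h₂ with
    | tip => exact absurd h₁.lt_b_of_bin (lt_irrefl _)
    | @bin _ _ q₁' q₂' E₁' E₂' _ _ _ _ _ g₁' g₂' hr₁' hr₂' hb' hp' hm' hD' =>
      subst hp hp' hm hm'
      have e := hD.symm.trans hD'
      have hd := disjoint_halves (r := mk p b) hb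
      have e₁ : E₁ = E₁' := by
        rw [← union_inter_left_of_subset (g₁.subset.trans hr₁) (g₂.subset.trans hr₂) hd, e,
          union_inter_left_of_subset (g₁'.subset.trans hr₁') (g₂'.subset.trans hr₂') hd]
      have e₂ : E₂ = E₂' := by
        rw [← union_inter_right_of_subset (g₁.subset.trans hr₁) (g₂.subset.trans hr₂) hd, e,
          union_inter_right_of_subset (g₁'.subset.trans hr₁') (g₂'.subset.trans hr₂') hd]
      subst e₁ e₂
      rw [ih₁ g₁', ih₂ g₂']

theorem Sem.tree_unique (h₁ : Sem k s₁ D) (h₂ : Sem k s₂ D) : s₁ = s₂ := by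
  cases h₁ with
  | nil =>
    generalize hE : (∅ : Set ℕ) = E at h₂
    cases h₂ with
    | nil => rfl
    | desc h => exact absurd hE.symm h.nonempty.ne_empty
  | desc h =>
    cases h₂ with
    | nil => exact absurd rfl h.nonempty.ne_empty
    | desc h' => exact h.tree_unique h'

theorem DescO.sem (h : DescO k s r D) : Sem k s D := by
  cases h with
  | nil => exact .nil
  | desc h => exact .desc h

theorem DescO.mono (h : DescO k s r₁ D) (hr : r₁ ≤ r₂) : DescO k s r₂ D := by
  cases h with
  | nil => exact .nil _
  | desc h hr' => exact .desc h (hr'.trans hr)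

theorem Desc.descO (h : Desc k s r D) : DescO k s r D := .desc h le_rfl

theorem DescO.of_empty (hD : D = ∅) : DescO k Nil r D := hD ▸ .nil r

/-! ### Queries -/

theorem Desc.member_iff (h : Desc k s r D) (x : ℕ) : member k x s = true ↔ x ∈ D := by
  induction h with
  | tip hp hpos hlt hD =>
    subst hp hD
    rw [Set.mem_ofPred_eq, mem_tip_iff hlt, member, prefixOf_eq, bitmapOf_eq, Nat.and_comm,
      Nat.and_two_pow]
    simp [(width_pos k).ne']
  | @bin a₁ a₂ q₁ q₂ E₁ E₂ E p b p' m h₁ h₂ hr₁ hr₂ hb hp hm hD ih₁ ih₂ =>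
    subst hp hm hD
    have hd := Set.disjoint_left.1 (disjoint_halves (r := mk p b) hb)
    have hE₁ := h₁.subset.trans hr₁
    have hE₂ := h₂.subset.trans hr₂
    -- A single point is treated as an interval of height 0, so that `branch_cases` applies.
    have hx : x ∈ (mk x 0).toSet := by simp [mem_toSet_iff]
    rw [member]
    rcases branch_cases (p := p) (b := b) (show (mk x 0).b < b from hb) hx with
      ⟨e, h⟩ | ⟨e, e', h⟩ | ⟨e, e', h⟩
    · have := Set.disjoint_left.1 h hx
      have n₁ : x ∉ E₁ := fun hn => this (lowerHalf_le hb (hE₁ hn))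
      have n₂ : x ∉ E₂ := fun hn => this (upperHalf_le hb (hE₂ hn))
      simp [e, n₁, n₂]
    · have n₂ : x ∉ E₂ := fun hn => hd (h hx) (hE₂ hn)
      simp [e, e', ih₁, n₂]
    · have n₁ : x ∉ E₁ := fun hn => hd (hE₁ hn) (h hx)
      simp [e, e', ih₂, n₁]

theorem Sem.member_iff (h : Sem k s D) (x : ℕ) : member k x s = true ↔ x ∈ D := by
  cases h with
  | nil => simp [member]
  | desc h => exact h.member_iff x

theorem Sem.null_iff (h : Sem k s D) : null s = true ↔ D = ∅ := by
  cases h with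
  | nil => simp [null]
  | desc h =>
    have hne := h.nonempty.ne_empty
    cases h <;> simp [null, hne]

theorem equal_iff (s₁ s₂ : IntSet) : equal s₁ s₂ = true ↔ s₁ = s₂ := by
  induction s₁ generalizing s₂ with
  | Bin p m l r ihl ihr =>
    cases s₂ <;> simp [equal, ihl, ihr]
    tauto
  | Tip kx bm => cases s₂ <;> simp [equal]
  | Nil => cases s₂ <;> simp [equal]

theorem nequal_eq_not_equal (s₁ s₂ : IntSet) : nequal s₁ s₂ = !equal s₁ s₂ := by
  induction s₁ generalizing s₂ with
  | Bin p m l r ihl ihr => cases s₂ <;> simp [equal, nequal, ihl, ihr, bne]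
  | Tip kx bm => cases s₂ <;> simp [equal, nequal, bne]
  | Nil => cases s₂ <;> simp [equal, nequal]

/-- One direction is uniqueness of the tree; for the other, `member` reads the set off the tree. -/
theorem Sem.equal_iff (h₁ : Sem k s₁ D₁) (h₂ : Sem k s₂ D₂) :
    equal s₁ s₂ = true ↔ D₁ = D₂ := by
  rw [Patricia.equal_iff]
  constructor
  · rintro rfl
    ext x
    rw [← h₁.member_iff, ← h₂.member_iff]
  · rintro rfl
    exact h₁.tree_unique h₂

theorem subset_union_left_iff {A B C U V : Set ℕ} (hA : A ⊆ U) (hC : C ⊆ V)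
    (h : Disjoint U V) : A ⊆ B ∪ C ↔ A ⊆ B := by
  refine ⟨fun hs x hx => ?_, fun hs => hs.trans Set.subset_union_left⟩
  rcases hs hx with h' | h'
  · exact h'
  · exact absurd (hC h') (Set.disjoint_left.1 h (hA hx))

theorem subset_union_right_iff {A B C U V : Set ℕ} (hA : A ⊆ V) (hB : B ⊆ U)
    (h : Disjoint U V) : A ⊆ B ∪ C ↔ A ⊆ C := by
  rw [Set.union_comm]
  exact subset_union_left_iff hA hB h.symm

theorem Desc.not_subset_of_disjoint (h₁ : Desc k s₁ r₁ D₁) (h₂ : D₂ ⊆ r₂.toSet)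
    (h : Disjoint r₁.toSet r₂.toSet) : ¬ D₁ ⊆ D₂ := by
  intro hs
  obtain ⟨x, hx⟩ := h₁.nonempty
  exact Set.disjoint_left.1 h (h₁.subset hx) (h₂ (hs hx))

/-- An inclusion of sets forces an inclusion of the least intervals, which justifies the rejecting
branches. The recursion may descend in the right tree alone, so an induction on the second
description, with the first fixed, is nested in the induction on the first. -/
theorem Desc.isSubsetOf_iff (h₁ : Desc k s₁ r₁ D₁) (h₂ : Desc k s₂ r₂ D₂) :
    isSubsetOf s₁ s₂ = true ↔ D₁ ⊆ D₂ := by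
  induction h₁ generalizing s₂ r₂ D₂ with
  | @tip q kx bm E hp hpos hlt hD =>
    have h₁ := Desc.tip hp hpos hlt hD
    induction h₂ with
    | @tip q' kx' bm' E' hp' hpos' hlt' hD' =>
      have h₂ := Desc.tip hp' hpos' hlt' hD'
      subst hp hp'
      simp only [isSubsetOf, Bool.and_eq_true, beq_iff_eq, Nat.xor_eq_zero_iff,
        Nat.mul_left_inj (width_pos k).ne']
      constructor
      · rintro ⟨rfl, e⟩
        subst hD hD'
        rintro _ ⟨j, hj, rfl⟩
        rw [e, Nat.testBit_and, Bool.and_eq_true] at hj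
        exact ⟨j, hj.2, rfl⟩
      · intro hs
        have hr := eq_of_le_of_b_eq (h₁.le_of_subset h₂.le_b (hs.trans h₂.subset)) rfl
        obtain rfl : q = q' := congrArg DyadicInterval.p hr
        refine ⟨rfl, Nat.eq_of_testBit_eq fun j => ?_⟩
        cases hj : bm.testBit j
        · simp [hj]
        · subst hD hD'
          obtain ⟨j', hj', e⟩ := hs ⟨j, hj, rfl⟩
          obtain rfl : j = j' := by simpa using e
          simp [hj, hj']
    | @bin a₁ a₂ q₁ q₂ E₁ E₂ E p b p' m g₁ g₂ hr₁ hr₂ hb hp' hm hD' ih₁ ih₂ =>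
      have h₂ := Desc.bin g₁ g₂ hr₁ hr₂ hb hp' hm hD'
      subst hp' hm
      rw [isSubsetOf]
      rcases branch_cases (p := p) h₂.lt_b_of_bin h₁.key_mem with ⟨e, h⟩ | ⟨e, e', h⟩ | ⟨e, e', h⟩
      · simp [e, h₁.not_subset_of_disjoint h₂.subset h]
      · simp [e, e', ih₁, hD', subset_union_left_iff (h₁.subset.trans h) (g₂.subset.trans hr₂)
          (disjoint_halves hb)]
      · simp [e, e', ih₂, hD', subset_union_right_iff (h₁.subset.trans h) (g₁.subset.trans hr₁)
          (disjoint_halves hb)]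
  | @bin c₁ c₂ t₁ t₂ F₁ F₂ F q c q' n f₁ f₂ ht₁ ht₂ hc hq hn hF IH₁ IH₂ =>
    have h₁ := Desc.bin f₁ f₂ ht₁ ht₂ hc hq hn hF
    induction h₂ with
    | tip hp' hpos' hlt' hD' =>
      have h₂ := Desc.tip hp' hpos' hlt' hD'
      simp only [isSubsetOf, Bool.false_eq_true, false_iff]
      intro hs
      have := b_le_of_le (h₁.le_of_subset h₂.le_b (hs.trans h₂.subset))
      exact absurd h₁.lt_b_of_bin this.not_gt
    | @bin a₁ a₂ q₁ q₂ E₁ E₂ E p b p' m g₁ g₂ hr₁ hr₂ hb hp' hm hD' ih₁ ih₂ =>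
      have h₂ := Desc.bin g₁ g₂ hr₁ hr₂ hb hp' hm hD'
      subst hq hn hp' hm
      have hle : F ⊆ E → mk q c ≤ mk p b := fun hs =>
        h₁.le_of_subset h₂.le_b (hs.trans h₂.subset)
      rw [isSubsetOf, shorter_two_pow hc hb, shorter_two_pow hb hc, isMatch_eq_not_noMatch]
      rcases lt_trichotomy b c with hbc | rfl | hbc
      · simp only [hbc, decide_true, if_true, Bool.false_eq_true, false_iff]
        exact fun hs => absurd (b_le_of_le (hle hs)) hbc.not_ge
      · have hd := disjoint_halves (r := mk p b) hb
        simp only [lt_irrefl, decide_false, Bool.false_eq_true, if_false, Bool.and_eq_true,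
          beq_iff_eq, IH₁ g₁, IH₂ g₂]
        constructor
        · rintro ⟨⟨-, s₁⟩, s₂⟩
          rw [hD', hF]
          exact Set.union_subset_union s₁ s₂
        · intro hs
          obtain rfl : q = p := congrArg DyadicInterval.p (eq_of_le_of_b_eq (hle hs) rfl)
          rw [hD', hF, Set.union_subset_iff, subset_union_left_iff (f₁.subset.trans ht₁)
            (g₂.subset.trans hr₂) hd, subset_union_right_iff (f₂.subset.trans ht₂)
            (g₁.subset.trans hr₁) hd] at hs
          exact ⟨⟨rfl, hs.1⟩, hs.2⟩
      · rcases branch_cases (p := p) hbc (base_mem ⟨q, c⟩) with ⟨e, h⟩ | ⟨e, e', h⟩ | ⟨e, e', h⟩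
        · simp [e, hbc, hbc.not_gt, h₁.not_subset_of_disjoint h₂.subset h]
        · simp [e, e', hbc, hbc.not_gt, ih₁, hD',
            subset_union_left_iff (h₁.subset.trans h) (g₂.subset.trans hr₂) (disjoint_halves hb)]
        · simp [e, e', hbc, hbc.not_gt, ih₂, hD',
            subset_union_right_iff (h₁.subset.trans h) (g₁.subset.trans hr₁) (disjoint_halves hb)]

theorem Sem.isSubsetOf_iff (h₁ : Sem k s₁ D₁) (h₂ : Sem k s₂ D₂) :
    isSubsetOf s₁ s₂ = true ↔ D₁ ⊆ D₂ := by
  cases h₁ with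
  | nil => simp [isSubsetOf]
  | desc h₁ =>
    cases h₂ with
    | nil =>
      have hne := h₁.nonempty.ne_empty
      cases h₁ <;> simp [isSubsetOf, hne]
    | desc h₂ => exact h₁.isSubsetOf_iff h₂

end Patricia

namespace Patricia

open IntSet DyadicInterval

variable {k : ℕ} {s s₁ s₂ : IntSet} {r r₁ r₂ : DyadicInterval} {D D₁ D₂ : Set ℕ}

theorem disjoint_of_p_ne (hb : r₁.b = r₂.b) (hp : r₁.p ≠ r₂.p) : Disjoint r₁.toSet r₂.toSet :=
  (disjoint_or_le_of_b_le hb.le).resolve_right fun h =>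
    hp (congrArg DyadicInterval.p (eq_of_le_of_b_eq h hb))

/-! ### Smart constructors -/

/-- Any representatives of the two disjoint intervals show the same branching bit as far as the
result matters: the interval found has `r₁` and `r₂` in opposite halves, so it is their least upper
bound. -/
theorem desc_link (h₁ : Desc k s₁ r₁ D₁) (h₂ : Desc k s₂ r₂ D₂)
    (hd : Disjoint r₁.toSet r₂.toSet) {x y : ℕ} (hx : x ∈ r₁.toSet) (hy : y ∈ r₂.toSet)
    (hr : IsLUB {r₁, r₂} r) : Desc k (link x s₁ y s₂) r (D₁ ∪ D₂) := by
  have hm : mask x (2 ^ Nat.log2 (x ^^^ y)) =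
      x / 2 ^ (Nat.log2 (x ^^^ y) + 1) * 2 ^ (Nat.log2 (x ^^^ y) + 1) :=
    mask_two_pow (Nat.succ_pos _) x
  rw [link, branchMask, highestBitMask, hm, zero_two_pow]
  rcases separate_of_disjoint hd hx hy rfl rfl with ⟨e, l₁, l₂⟩ | ⟨e, l₂, l₁⟩
  · rw [hr.unique (isLUB_of_halves (Nat.succ_pos _) l₁ l₂), e]
    exact .bin h₁ h₂ l₁ l₂ (Nat.succ_pos _) rfl rfl rfl
  · rw [Set.pair_comm] at hr
    rw [hr.unique (isLUB_of_halves (Nat.succ_pos _) l₂ l₁), e]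
    exact .bin h₂ h₁ l₂ l₁ (Nat.succ_pos _) rfl rfl (Set.union_comm _ _)

/-- When one child is empty, the other survives alone; its interval may be far smaller than the
node's, but still lies inside it. -/
theorem descO_bin {p b : ℕ} (hb : 0 < b) (h₁ : DescO k s₁ (mk p b).lowerHalf D₁)
    (h₂ : DescO k s₂ (mk p b).upperHalf D₂) :
    DescO k (bin (p * 2 ^ b) (2 ^ (b - 1)) s₁ s₂) ⟨p, b⟩ (D₁ ∪ D₂) := by
  cases h₁ with
  | nil =>
    cases h₂ with
    | nil => exact .of_empty (by simp)
    | desc h₂ l₂ =>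
      have h := DescO.desc h₂ (l₂.trans (upperHalf_le hb))
      rw [Set.empty_union]
      -- `bin` computes only once the head constructor of the tree is known.
      cases h₂ <;> exact h
  | desc h₁ l₁ =>
    cases h₂ with
    | nil =>
      have h := DescO.desc h₁ (l₁.trans (lowerHalf_le hb))
      rw [Set.union_empty]
      cases h₁ <;> exact h
    | desc h₂ l₂ =>
      have h := (Desc.bin h₁ h₂ l₁ l₂ hb rfl rfl rfl).descO
      cases h₁ <;> cases h₂ <;> exact h

theorem descO_tip {p bm : ℕ} (hlt : bm < 2 ^ width k)
    (hD : ∀ x, x ∈ D ↔ x / 2 ^ k = p ∧ bm.testBit (x % 2 ^ k) = true) :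
    DescO k (tip (p * width k) bm) ⟨p, k⟩ D := by
  rw [tip]
  split_ifs with h
  · subst h
    exact .of_empty (by ext x; simp [hD])
  · exact (Desc.of_tip (Nat.pos_of_ne_zero h) hlt hD).descO

/-! ### Insertion and union -/

/-- Gives the induction hypotheses the exact interval they require, together with the bound by a
half that rebuilding the node requires. -/
theorem lub_of_left_le {r' : DyadicInterval} (h : r₁ ≤ r') (hr' : r₂ ≤ r') :
    ∃ q, IsLUB {r₁, r₂} q ∧ q ≤ r' := by
  obtain ⟨q, hq⟩ := exists_isLUB r₁ r₂
  exact ⟨q, hq, hq.2 (by rintro _ (rfl | rfl) <;> assumption)⟩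

/-- If the leaf falls into a half of a node, the node's interval is already the least upper bound
and only one child changes. The interval `r` varies in the induction because each child has its own
least upper bound. -/
theorem desc_insertBM {kx bm : ℕ} (h₁ : Desc k (Tip kx bm) r₁ D₁) (h₂ : Desc k s r₂ D₂)
    (hr : IsLUB {r₁, r₂} r) : Desc k (insertBM kx bm s) r (D₁ ∪ D₂) := by
  induction h₂ generalizing r with
  | @tip q kx' bm' E hp hpos hlt hD =>
    have h₂ := Desc.tip hp hpos hlt hD
    rw [insertBM]
    obtain ⟨e, e', hpos₁, hlt₁, hD₁⟩ := h₁.tip_inv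
    obtain ⟨-, -, -, -, hD₂⟩ := h₂.tip_inv
    split_ifs with hk
    · subst hp
      have hq : q = r₁.p := Nat.eq_of_mul_eq_mul_right (width_pos k) (hk.trans e')
      have hr₁ : r₁ = ⟨q, k⟩ := DyadicInterval.ext hq.symm e
      subst hr₁
      rw [hr.unique (isLUB_of_le le_rfl)]
      refine .of_tip ?_ (Nat.or_lt_two_pow hlt₁ hlt) fun x => ?_
      · have := Nat.left_le_or (n := bm) (m := bm')
        omega
      · simp only [Set.mem_union, hD₁, hD₂, Nat.testBit_or, Bool.or_eq_true]
        tauto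
    · refine desc_link h₁ h₂ ?_ h₁.key_mem h₂.key_mem hr
      exact disjoint_of_p_ne e fun h => hk (by rw [e', h, hp])
  | @bin a₁ a₂ q₁ q₂ E₁ E₂ E p b p' m g₁ g₂ hr₁ hr₂ hb hp hm hD ih₁ ih₂ =>
    have h₂ := Desc.bin g₁ g₂ hr₁ hr₂ hb hp hm hD
    subst hp hm
    have hlt : r₁.b < b := h₁.tip_inv.1.trans_lt h₂.lt_b_of_bin
    rw [insertBM]
    rcases branch_cases (p := p) hlt h₁.key_mem with ⟨e, h⟩ | ⟨e, e', h⟩ | ⟨e, e', h⟩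
    · simp only [e, if_true]
      exact desc_link h₁ h₂ h h₁.key_mem (base_mem ⟨p, b⟩) hr
    · rw [hr.unique (isLUB_of_le (h.trans (lowerHalf_le hb)))]
      obtain ⟨q, hq, hq'⟩ := lub_of_left_le h hr₁
      simp only [e, e', if_true, Bool.false_eq_true, if_false]
      exact .bin (ih₁ hq) g₂ hq' hr₂ hb rfl rfl (by rw [hD, Set.union_assoc])
    · rw [hr.unique (isLUB_of_le (h.trans (upperHalf_le hb)))]
      obtain ⟨q, hq, hq'⟩ := lub_of_left_le h hr₂
      simp only [e, e', Bool.false_eq_true, if_false]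
      exact .bin g₁ (ih₂ hq) hr₁ hq' hb rfl rfl (by rw [hD, Set.union_left_comm])

theorem desc_singleton (k x : ℕ) : Desc k (singleton k x) ⟨x / 2 ^ k, k⟩ {x} := by
  rw [singleton, prefixOf_eq, bitmapOf_eq]
  refine .of_tip (by positivity) ?_ fun y => ?_
  · exact Nat.pow_lt_pow_right one_lt_two (Nat.mod_lt _ (by positivity))
  · rw [Nat.testBit_two_pow, Set.mem_singleton_iff, decide_eq_true_iff]
    constructor
    · rintro rfl
      exact ⟨rfl, rfl⟩
    · rintro ⟨h, h'⟩
      rw [← Nat.div_add_mod y (2 ^ k), h, ← h', Nat.div_add_mod]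

theorem sem_insert (h : Sem k s D) (x : ℕ) : Sem k (insert k x s) (D ∪ {x}) := by
  have hx := desc_singleton k x
  rw [Set.union_comm, insert]
  cases h with
  | nil =>
    rw [Set.union_empty]
    exact .desc hx
  | @desc _ r₂ _ h =>
    obtain ⟨r, hr⟩ := exists_isLUB ⟨x / 2 ^ k, k⟩ r₂
    exact .desc (desc_insertBM hx h hr)

theorem sem_fromList (k : ℕ) (xs : List ℕ) : Sem k (fromList k xs) {x | x ∈ xs} := by
  have H : ∀ (xs : List ℕ) (s : IntSet) (D : Set ℕ), Sem k s D →
      Sem k (xs.foldl (fun t x => insert k x t) s) (D ∪ {x | x ∈ xs}) := by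
    intro xs
    induction xs with
    | nil =>
      intro s D h
      simpa using h
    | cons a xs ih =>
      intro s D h
      have e : D ∪ {x | x ∈ a :: xs} = (D ∪ {a}) ∪ {x | x ∈ xs} := by
        ext x
        simp [or_assoc, or_left_comm]
      rw [e]
      exact ih _ _ (sem_insert h a)
  simpa [fromList] using H xs Nil ∅ .nil

theorem desc_union (h₁ : Desc k s₁ r₁ D₁) (h₂ : Desc k s₂ r₂ D₂) (hr : IsLUB {r₁, r₂} r) :
    Desc k (union s₁ s₂) r (D₁ ∪ D₂) := by
  induction h₁ generalizing s₂ r₂ D₂ r with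
  | @tip q kx bm E hp hpos hlt hD =>
    have h₁ := Desc.tip hp hpos hlt hD
    rw [union]
    exact desc_insertBM h₁ h₂ hr
  | @bin c₁ c₂ t₁ t₂ F₁ F₂ F q c q' n f₁ f₂ ht₁ ht₂ hc hq hn hF IH₁ IH₂ =>
    have h₁ := Desc.bin f₁ f₂ ht₁ ht₂ hc hq hn hF
    induction h₂ generalizing r with
    | tip hp hpos hlt hD =>
      have h₂ := Desc.tip hp hpos hlt hD
      rw [union, Set.union_comm]
      rw [Set.pair_comm] at hr
      exact desc_insertBM h₂ h₁ hr
    | @bin a₁ a₂ q₁ q₂ E₁ E₂ E p b p' m g₁ g₂ hr₁ hr₂ hb hp' hm hD' ih₁ ih₂ =>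
      have h₂ := Desc.bin g₁ g₂ hr₁ hr₂ hb hp' hm hD'
      subst hq hn hp' hm
      have hxq := base_mem ⟨q, c⟩
      have hxp := base_mem ⟨p, b⟩
      rw [union, shorter_two_pow hc hb, shorter_two_pow hb hc]
      rcases lt_trichotomy b c with hbc | rfl | hbc
      · simp only [hbc, decide_true, if_true]
        rcases branch_cases (p := q) hbc hxp with ⟨e, h⟩ | ⟨e, e', h⟩ | ⟨e, e', h⟩
        · simp only [e, if_true]
          exact desc_link h₁ h₂ h.symm hxq hxp hr
        · rw [hr.unique (isLUB_of_ge (h.trans (lowerHalf_le hc)))]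
          obtain ⟨u, hu, hu'⟩ := lub_of_left_le ht₁ h
          simp only [e, e', if_true, Bool.false_eq_true, if_false]
          exact .bin (IH₁ h₂ hu) f₂ hu' ht₂ hc rfl rfl (by rw [hF, Set.union_right_comm])
        · rw [hr.unique (isLUB_of_ge (h.trans (upperHalf_le hc)))]
          obtain ⟨u, hu, hu'⟩ := lub_of_left_le ht₂ h
          simp only [e, e', Bool.false_eq_true, if_false]
          exact .bin f₁ (IH₂ h₂ hu) ht₁ hu' hc rfl rfl (by rw [hF, Set.union_assoc])
      · simp only [lt_irrefl, decide_false, Bool.false_eq_true, if_false]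
        split_ifs with e
        · obtain rfl : q = p := Nat.eq_of_mul_eq_mul_right (by positivity) e
          rw [hr.unique (isLUB_of_le le_rfl)]
          obtain ⟨u, hu, hu'⟩ := lub_of_left_le ht₁ hr₁
          obtain ⟨v, hv, hv'⟩ := lub_of_left_le ht₂ hr₂
          exact .bin (IH₁ g₁ hu) (IH₂ g₂ hv) hu' hv' hb rfl rfl
            (by rw [hF, hD', Set.union_union_union_comm])
        · exact desc_link h₁ h₂ (disjoint_of_p_ne rfl fun h => e (congrArg (· * 2 ^ b) h)) hxq hxp hr
      · simp only [hbc, hbc.not_gt, decide_true, decide_false, if_true, Bool.false_eq_true,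
          if_false]
        rcases branch_cases (p := p) hbc hxq with ⟨e, h⟩ | ⟨e, e', h⟩ | ⟨e, e', h⟩
        · simp only [e, if_true]
          exact desc_link h₁ h₂ h hxq hxp hr
        · rw [hr.unique (isLUB_of_le (h.trans (lowerHalf_le hb)))]
          obtain ⟨u, hu, hu'⟩ := lub_of_left_le h hr₁
          simp only [e, e', if_true, Bool.false_eq_true, if_false]
          exact .bin (ih₁ hu) g₂ hu' hr₂ hb rfl rfl (by rw [hD', Set.union_assoc])
        · rw [hr.unique (isLUB_of_le (h.trans (upperHalf_le hb)))]
          obtain ⟨u, hu, hu'⟩ := lub_of_left_le h hr₂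
          simp only [e, e', Bool.false_eq_true, if_false]
          exact .bin g₁ (ih₂ hu) hr₁ hu' hb rfl rfl (by rw [hD', Set.union_left_comm])

theorem sem_union (h₁ : Sem k s₁ D₁) (h₂ : Sem k s₂ D₂) : Sem k (union s₁ s₂) (D₁ ∪ D₂) := by
  cases h₁ with
  | nil =>
    rw [union, Set.empty_union]
    exact h₂
  | @desc _ r₁ _ h₁ =>
    cases h₂ with
    | nil =>
      have h := Sem.desc h₁
      rw [Set.union_empty]
      cases h₁ <;> (rw [union]; exact h)
    | @desc _ r₂ _ h₂ =>
      obtain ⟨r, hr⟩ := exists_isLUB r₁ r₂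
      exact .desc (desc_union h₁ h₂ hr)

/-! ### Intersection -/

theorem Desc.inter_eq_empty (h₁ : Desc k s₁ r₁ D₁) (h₂ : Desc k s₂ r₂ D₂)
    (h : Disjoint r₁.toSet r₂.toSet) : D₁ ∩ D₂ = ∅ :=
  (h.mono h₁.subset h₂.subset).inter_eq

theorem Desc.diff_eq_left (h₁ : Desc k s₁ r₁ D₁) (h₂ : Desc k s₂ r₂ D₂)
    (h : Disjoint r₁.toSet r₂.toSet) : D₁ \ D₂ = D₁ :=
  (h.mono h₁.subset h₂.subset).sdiff_eq_left

theorem inter_union_left {A B C U V : Set ℕ} (hA : A ⊆ U) (hC : C ⊆ V) (h : Disjoint U V) :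
    A ∩ (B ∪ C) = A ∩ B := by
  rw [Set.inter_union_distrib_left, (h.mono hA hC).inter_eq, Set.union_empty]

theorem inter_union_right {A B C U V : Set ℕ} (hA : A ⊆ V) (hB : B ⊆ U) (h : Disjoint U V) :
    A ∩ (B ∪ C) = A ∩ C := by
  rw [Set.union_comm, inter_union_left hA hB h.symm]

theorem union_inter_union {A B A' B' U V : Set ℕ} (hA : A ⊆ U) (hB : B ⊆ V) (hA' : A' ⊆ U)
    (hB' : B' ⊆ V) (h : Disjoint U V) : (A ∪ B) ∩ (A' ∪ B') = A ∩ A' ∪ B ∩ B' := by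
  rw [Set.union_inter_distrib_right, inter_union_left hA hB' h, inter_union_right hB hA' h]

/-- Pieces in opposite halves do not interact, so the operation acts on the two children separately.
-/
theorem union_diff_union {A B A' B' U V : Set ℕ} (hA : A ⊆ U) (hB : B ⊆ V) (hA' : A' ⊆ U)
    (hB' : B' ⊆ V) (h : Disjoint U V) : (A ∪ B) \ (A' ∪ B') = A \ A' ∪ B \ B' := by
  have h₁ := Set.disjoint_left.1 (h.mono hA hB')
  have h₂ := Set.disjoint_left.1 (h.mono hA' hB)
  ext x
  have := @h₁ x
  have := @h₂ x
  simp only [Set.mem_sdiff, Set.mem_union]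
  tauto

theorem diff_union_left {A B C U V : Set ℕ} (hA : A ⊆ U) (hC : C ⊆ V) (h : Disjoint U V) :
    A \ (B ∪ C) = A \ B := by
  rw [← Set.sdiff_sdiff, sdiff_right_comm, (h.mono hA hC).sdiff_eq_left]

theorem diff_union_right {A B C U V : Set ℕ} (hA : A ⊆ V) (hB : B ⊆ U) (h : Disjoint U V) :
    A \ (B ∪ C) = A \ C := by
  rw [Set.union_comm, diff_union_left hA hB h.symm]

theorem union_diff_left {A B C U V : Set ℕ} (hB : B ⊆ V) (hC : C ⊆ U) (h : Disjoint U V) :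
    (A ∪ B) \ C = A \ C ∪ B := by
  rw [Set.union_sdiff_distrib, (h.symm.mono hB hC).sdiff_eq_left]

theorem union_diff_right {A B C U V : Set ℕ} (hA : A ⊆ U) (hC : C ⊆ V) (h : Disjoint U V) :
    (A ∪ B) \ C = A ∪ B \ C := by
  rw [Set.union_sdiff_distrib, (h.mono hA hC).sdiff_eq_left]

theorem descO_intersectBM {kx bm : ℕ} (h₁ : Desc k (Tip kx bm) r₁ D₁) (h₂ : Desc k s r₂ D₂) :
    DescO k (intersectBM kx bm s) r₁ (D₁ ∩ D₂) := by
  induction h₂ with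
  | @tip q kx' bm' E hp hpos hlt hD =>
    have h₂ := Desc.tip hp hpos hlt hD
    rw [intersectBM]
    obtain ⟨e, e', hpos₁, hlt₁, hD₁⟩ := h₁.tip_inv
    obtain ⟨-, -, -, -, hD₂⟩ := h₂.tip_inv
    split_ifs with hk
    · subst hp
      have hq : r₁.p = q := Nat.eq_of_mul_eq_mul_right (width_pos k) (e'.symm.trans hk)
      have hr₁ : r₁ = ⟨q, k⟩ := DyadicInterval.ext hq e
      subst hr₁
      rw [hk]
      refine descO_tip (Nat.and_lt_two_pow _ hlt) fun x => ?_
      simp only [Set.mem_inter_iff, hD₁, hD₂, Nat.testBit_and, Bool.and_eq_true]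
      tauto
    · refine .of_empty (h₁.inter_eq_empty h₂ ?_)
      exact disjoint_of_p_ne e fun h => hk (by rw [e', h, hp])
  | @bin a₁ a₂ q₁ q₂ E₁ E₂ E p b p' m g₁ g₂ hr₁ hr₂ hb hp hm hD ih₁ ih₂ =>
    have h₂ := Desc.bin g₁ g₂ hr₁ hr₂ hb hp hm hD
    have hd := disjoint_halves (r := mk p b) hb
    subst hp hm
    have hlt : r₁.b < b := h₁.tip_inv.1.trans_lt h₂.lt_b_of_bin
    rw [intersectBM]
    rcases branch_cases (p := p) hlt h₁.key_mem with ⟨e, h⟩ | ⟨e, e', h⟩ | ⟨e, e', h⟩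
    · simp only [e, if_true]
      exact .of_empty (h₁.inter_eq_empty h₂ h)
    · simp only [e, e', if_true, Bool.false_eq_true, if_false]
      rwa [hD, inter_union_left (h₁.subset.trans h) (g₂.subset.trans hr₂) hd]
    · simp only [e, e', Bool.false_eq_true, if_false]
      rwa [hD, inter_union_right (h₁.subset.trans h) (g₁.subset.trans hr₁) hd]

theorem descO_intersection (h₁ : Desc k s₁ r₁ D₁) (h₂ : Desc k s₂ r₂ D₂) :
    DescO k (intersection s₁ s₂) r₁ (D₁ ∩ D₂) := by
  induction h₁ generalizing s₂ r₂ D₂ with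
  | @tip q kx bm E hp hpos hlt hD =>
    have h₁ := Desc.tip hp hpos hlt hD
    rw [intersection]
    exact descO_intersectBM h₁ h₂
  | @bin c₁ c₂ t₁ t₂ F₁ F₂ F q c q' n f₁ f₂ ht₁ ht₂ hc hq hn hF IH₁ IH₂ =>
    have h₁ := Desc.bin f₁ f₂ ht₁ ht₂ hc hq hn hF
    induction h₂ with
    | @tip q kx bm E hp hpos hlt hD =>
      have h₂ := Desc.tip hp hpos hlt hD
      rw [intersection, Set.inter_comm]
      have h := descO_intersectBM h₂ h₁
      -- The swapped call bounds the result by the leaf's interval, but the node's is wanted. If the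
      -- leaf lies inside, the bound weakens; if it is disjoint, the result denotes the empty set
      -- and is `Nil` by uniqueness.
      rcases disjoint_or_le_of_b_le h₁.lt_b_of_bin.le (r₁ := ⟨q, k⟩) with hd | hle
      · generalize intersectBM kx bm (Bin q' n c₁ c₂) = t at h ⊢
        rw [h₂.inter_eq_empty h₁ hd] at h ⊢
        rw [h.sem.tree_unique .nil]
        exact .nil _
      · exact h.mono hle
    | @bin a₁ a₂ q₁ q₂ E₁ E₂ E p b p' m g₁ g₂ hr₁ hr₂ hb hp' hm hD' ih₁ ih₂ =>
      have h₂ := Desc.bin g₁ g₂ hr₁ hr₂ hb hp' hm hD'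
      have hd := disjoint_halves (r := mk p b) hb
      have hd' := disjoint_halves (r := mk q c) hc
      subst hq hn hp' hm
      have hxq := base_mem ⟨q, c⟩
      have hxp := base_mem ⟨p, b⟩
      rw [intersection, shorter_two_pow hc hb, shorter_two_pow hb hc]
      rcases lt_trichotomy b c with hbc | rfl | hbc
      · simp only [hbc, decide_true, if_true]
        rcases branch_cases (p := q) hbc hxp with ⟨e, h⟩ | ⟨e, e', h⟩ | ⟨e, e', h⟩
        · simp only [e, if_true]
          exact .of_empty (h₁.inter_eq_empty h₂ h.symm)
        · simp only [e, e', if_true, Bool.false_eq_true, if_false]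
          rw [hF, Set.inter_comm, inter_union_left (h₂.subset.trans h) (f₂.subset.trans ht₂) hd',
            Set.inter_comm]
          exact (IH₁ h₂).mono (ht₁.trans (lowerHalf_le hc))
        · simp only [e, e', Bool.false_eq_true, if_false]
          rw [hF, Set.inter_comm, inter_union_right (h₂.subset.trans h) (f₁.subset.trans ht₁) hd',
            Set.inter_comm]
          exact (IH₂ h₂).mono (ht₂.trans (upperHalf_le hc))
      · simp only [lt_irrefl, decide_false, Bool.false_eq_true, if_false]
        split_ifs with e
        · obtain rfl : q = p := Nat.eq_of_mul_eq_mul_right (by positivity) e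
          rw [hF, hD', union_inter_union (f₁.subset.trans ht₁) (f₂.subset.trans ht₂)
            (g₁.subset.trans hr₁) (g₂.subset.trans hr₂) hd]
          exact descO_bin hb ((IH₁ g₁).mono ht₁) ((IH₂ g₂).mono ht₂)
        · exact .of_empty (h₁.inter_eq_empty h₂ (disjoint_of_p_ne rfl fun h => e (congrArg (· * 2 ^ b) h)))
      · simp only [hbc, hbc.not_gt, decide_true, decide_false, if_true, Bool.false_eq_true,
          if_false]
        rcases branch_cases (p := p) hbc hxq with ⟨e, h⟩ | ⟨e, e', h⟩ | ⟨e, e', h⟩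
        · simp only [e, if_true]
          exact .of_empty (h₁.inter_eq_empty h₂ h)
        · simp only [e, e', if_true, Bool.false_eq_true, if_false]
          rwa [hD', inter_union_left (h₁.subset.trans h) (g₂.subset.trans hr₂) hd]
        · simp only [e, e', Bool.false_eq_true, if_false]
          rwa [hD', inter_union_right (h₁.subset.trans h) (g₁.subset.trans hr₁) hd]

theorem sem_intersection (h₁ : Sem k s₁ D₁) (h₂ : Sem k s₂ D₂) :
    Sem k (intersection s₁ s₂) (D₁ ∩ D₂) := by
  cases h₁ with
  | nil =>
    rw [intersection, Set.empty_inter]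
    exact .nil
  | desc h₁ =>
    cases h₂ with
    | nil =>
      rw [Set.inter_empty]
      cases h₁ <;> (rw [intersection]; exact .nil)
    | desc h₂ => exact (descO_intersection h₁ h₂).sem

/-! ### Deletion and difference -/

theorem diff_bitmap_lt {a b n : ℕ} (h : a < 2 ^ n) : a ^^^ (a &&& b) < 2 ^ n :=
  Nat.xor_lt_two_pow h (Nat.and_le_left.trans_lt h)

theorem testBit_diff_bitmap (a b i : ℕ) :
    (a ^^^ (a &&& b)).testBit i = true ↔ a.testBit i = true ∧ ¬ b.testBit i = true := by
  rw [Nat.testBit_xor, Nat.testBit_and]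
  cases a.testBit i <;> cases b.testBit i <;> simp

theorem descO_deleteBM {kx bm : ℕ} (h₁ : Desc k (Tip kx bm) r₁ D₁) (h₂ : Desc k s r₂ D₂) :
    DescO k (deleteBM kx bm s) r₂ (D₂ \ D₁) := by
  induction h₂ with
  | @tip q kx' bm' E hp hpos hlt hD =>
    have h₂ := Desc.tip hp hpos hlt hD
    rw [deleteBM]
    obtain ⟨e, e', hpos₁, hlt₁, hD₁⟩ := h₁.tip_inv
    obtain ⟨-, -, -, -, hD₂⟩ := h₂.tip_inv
    split_ifs with hk
    · subst hp
      have hq : q = r₁.p := Nat.eq_of_mul_eq_mul_right (width_pos k) (hk.trans e')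
      have hr₁ : r₁ = ⟨q, k⟩ := DyadicInterval.ext hq.symm e
      subst hr₁
      rw [← hk]
      refine descO_tip (diff_bitmap_lt hlt) fun x => ?_
      simp only [Set.mem_sdiff, hD₁, hD₂, testBit_diff_bitmap]
      tauto
    · rw [h₂.diff_eq_left h₁]
      · exact h₂.descO
      · exact (disjoint_of_p_ne e fun h => hk (by rw [e', h, hp])).symm
  | @bin a₁ a₂ q₁ q₂ E₁ E₂ E p b p' m g₁ g₂ hr₁ hr₂ hb hp hm hD ih₁ ih₂ =>
    have h₂ := Desc.bin g₁ g₂ hr₁ hr₂ hb hp hm hD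
    have hd := disjoint_halves (r := mk p b) hb
    subst hp hm
    have hlt : r₁.b < b := h₁.tip_inv.1.trans_lt h₂.lt_b_of_bin
    rw [deleteBM]
    rcases branch_cases (p := p) hlt h₁.key_mem with ⟨e, h⟩ | ⟨e, e', h⟩ | ⟨e, e', h⟩
    · simp only [e, if_true]
      rw [h₂.diff_eq_left h₁ h.symm]
      exact h₂.descO
    · simp only [e, e', if_true, Bool.false_eq_true, if_false]
      rw [hD, union_diff_left (g₂.subset.trans hr₂) (h₁.subset.trans h) hd]
      exact descO_bin hb (ih₁.mono hr₁) (g₂.descO.mono hr₂)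
    · simp only [e, e', Bool.false_eq_true, if_false]
      rw [hD, union_diff_right (g₁.subset.trans hr₁) (h₁.subset.trans h) hd]
      exact descO_bin hb (g₁.descO.mono hr₁) (ih₂.mono hr₂)

theorem sem_delete (h : Sem k s D) (x : ℕ) : Sem k (delete k x s) (D \ {x}) := by
  rw [delete]
  cases h with
  | nil =>
    rw [Set.empty_sdiff]
    exact .nil
  | desc h => exact (descO_deleteBM (desc_singleton k x) h).sem

theorem descO_differenceTip {kx bm : ℕ} (h₁ : Desc k (Tip kx bm) r₁ D₁) (h₂ : Desc k s r₂ D₂) :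
    DescO k (differenceTip kx bm s) r₁ (D₁ \ D₂) := by
  induction h₂ with
  | @tip q kx' bm' E hp hpos hlt hD =>
    have h₂ := Desc.tip hp hpos hlt hD
    rw [differenceTip]
    obtain ⟨e, e', hpos₁, hlt₁, hD₁⟩ := h₁.tip_inv
    obtain ⟨-, -, -, -, hD₂⟩ := h₂.tip_inv
    split_ifs with hk
    · subst hp
      have hq : r₁.p = q := Nat.eq_of_mul_eq_mul_right (width_pos k) (e'.symm.trans hk)
      have hr₁ : r₁ = ⟨q, k⟩ := DyadicInterval.ext hq e
      subst hr₁
      rw [hk]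
      refine descO_tip (diff_bitmap_lt hlt₁) fun x => ?_
      simp only [Set.mem_sdiff, hD₁, hD₂, testBit_diff_bitmap]
      tauto
    · rw [h₁.diff_eq_left h₂]
      · exact h₁.descO
      · exact disjoint_of_p_ne e fun h => hk (by rw [e', h, hp])
  | @bin a₁ a₂ q₁ q₂ E₁ E₂ E p b p' m g₁ g₂ hr₁ hr₂ hb hp hm hD ih₁ ih₂ =>
    have h₂ := Desc.bin g₁ g₂ hr₁ hr₂ hb hp hm hD
    have hd := disjoint_halves (r := mk p b) hb
    subst hp hm
    have hlt : r₁.b < b := h₁.tip_inv.1.trans_lt h₂.lt_b_of_bin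
    rw [differenceTip]
    rcases branch_cases (p := p) hlt h₁.key_mem with ⟨e, h⟩ | ⟨e, e', h⟩ | ⟨e, e', h⟩
    · simp only [e, if_true]
      rw [h₁.diff_eq_left h₂ h]
      exact h₁.descO
    · simp only [e, e', if_true, Bool.false_eq_true, if_false]
      rwa [hD, diff_union_left (h₁.subset.trans h) (g₂.subset.trans hr₂) hd]
    · simp only [e, e', Bool.false_eq_true, if_false]
      rwa [hD, diff_union_right (h₁.subset.trans h) (g₁.subset.trans hr₁) hd]

theorem descO_difference (h₁ : Desc k s₁ r₁ D₁) (h₂ : Desc k s₂ r₂ D₂) :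
    DescO k (difference s₁ s₂) r₁ (D₁ \ D₂) := by
  induction h₁ generalizing s₂ r₂ D₂ with
  | @tip q kx bm E hp hpos hlt hD =>
    have h₁ := Desc.tip hp hpos hlt hD
    rw [difference]
    exact descO_differenceTip h₁ h₂
  | @bin c₁ c₂ t₁ t₂ F₁ F₂ F q c q' n f₁ f₂ ht₁ ht₂ hc hq hn hF IH₁ IH₂ =>
    have h₁ := Desc.bin f₁ f₂ ht₁ ht₂ hc hq hn hF
    induction h₂ with
    | @tip q kx bm E hp hpos hlt hD =>
      have h₂ := Desc.tip hp hpos hlt hD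
      rw [difference]
      exact descO_deleteBM h₂ h₁
    | @bin a₁ a₂ q₁ q₂ E₁ E₂ E p b p' m g₁ g₂ hr₁ hr₂ hb hp' hm hD' ih₁ ih₂ =>
      have h₂ := Desc.bin g₁ g₂ hr₁ hr₂ hb hp' hm hD'
      have hd := disjoint_halves (r := mk p b) hb
      have hd' := disjoint_halves (r := mk q c) hc
      subst hq hn hp' hm
      have hxq := base_mem ⟨q, c⟩
      have hxp := base_mem ⟨p, b⟩
      rw [difference, shorter_two_pow hc hb, shorter_two_pow hb hc]
      rcases lt_trichotomy b c with hbc | rfl | hbc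
      · simp only [hbc, decide_true, if_true]
        rcases branch_cases (p := q) hbc hxp with ⟨e, h⟩ | ⟨e, e', h⟩ | ⟨e, e', h⟩
        · simp only [e, if_true]
          rw [h₁.diff_eq_left h₂ h.symm]
          exact h₁.descO
        · simp only [e, e', if_true, Bool.false_eq_true, if_false]
          rw [hF, union_diff_left (f₂.subset.trans ht₂) (h₂.subset.trans h) hd']
          exact descO_bin hc ((IH₁ h₂).mono ht₁) (f₂.descO.mono ht₂)
        · simp only [e, e', Bool.false_eq_true, if_false]
          rw [hF, union_diff_right (f₁.subset.trans ht₁) (h₂.subset.trans h) hd']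
          exact descO_bin hc (f₁.descO.mono ht₁) ((IH₂ h₂).mono ht₂)
      · simp only [lt_irrefl, decide_false, Bool.false_eq_true, if_false]
        split_ifs with e
        · obtain rfl : q = p := Nat.eq_of_mul_eq_mul_right (by positivity) e
          rw [hF, hD', union_diff_union (f₁.subset.trans ht₁) (f₂.subset.trans ht₂)
            (g₁.subset.trans hr₁) (g₂.subset.trans hr₂) hd]
          exact descO_bin hb ((IH₁ g₁).mono ht₁) ((IH₂ g₂).mono ht₂)
        · rw [h₁.diff_eq_left h₂ (disjoint_of_p_ne rfl fun h => e (congrArg (· * 2 ^ b) h))]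
          exact h₁.descO
      · simp only [hbc, hbc.not_gt, decide_true, decide_false, if_true, Bool.false_eq_true,
          if_false]
        rcases branch_cases (p := p) hbc hxq with ⟨e, h⟩ | ⟨e, e', h⟩ | ⟨e, e', h⟩
        · simp only [e, if_true]
          rw [h₁.diff_eq_left h₂ h]
          exact h₁.descO
        · simp only [e, e', if_true, Bool.false_eq_true, if_false]
          rwa [hD', diff_union_left (h₁.subset.trans h) (g₂.subset.trans hr₂) hd]
        · simp only [e, e', Bool.false_eq_true, if_false]
          rwa [hD', diff_union_right (h₁.subset.trans h) (g₁.subset.trans hr₁) hd]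

theorem sem_difference (h₁ : Sem k s₁ D₁) (h₂ : Sem k s₂ D₂) :
    Sem k (difference s₁ s₂) (D₁ \ D₂) := by
  cases h₁ with
  | nil =>
    rw [difference, Set.empty_sdiff]
    exact .nil
  | desc h₁ =>
    cases h₂ with
    | nil =>
      have h := Sem.desc h₁
      rw [Set.sdiff_empty]
      cases h₁ <;> (rw [difference]; exact h)
    | desc h₂ => exact (descO_difference h₁ h₂).sem

end Patricia

namespace Patricia

open IntSet DyadicInterval

variable {k : ℕ} {s s₁ s₂ : IntSet} {r r₁ r₂ : DyadicInterval} {D D₁ D₂ : Set ℕ}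

/-! ### The bits of a word -/

/-- The indices of the bits set in `x`, in increasing order. -/
def setBits (x : ℕ) : List ℕ := (List.range x.size).filter (fun i => x.testBit i)

theorem mem_setBits {x i : ℕ} : i ∈ setBits x ↔ x.testBit i = true := by
  rw [setBits, List.mem_filter, List.mem_range, Nat.lt_size, and_iff_right_iff_imp]
  exact Nat.ge_two_pow_of_testBit

theorem pairwise_setBits (x : ℕ) : (setBits x).Pairwise (· < ·) :=
  List.pairwise_lt_range.filter _

theorem popCount_eq_length (x : ℕ) : popCount x = (setBits x).length := by
  rw [← List.toFinset_card_of_nodup ((pairwise_setBits x).imp ne_of_lt), popCount]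
  congr 1
  ext i
  simp [setBits]

theorem testBit_padicValNat {x : ℕ} (hx : x ≠ 0) : x.testBit (padicValNat 2 x) = true := by
  have hnd := pow_succ_padicValNat_not_dvd (p := 2) hx
  obtain ⟨c, hc⟩ : 2 ^ padicValNat 2 x ∣ x := pow_padicValNat_dvd
  rw [Nat.testBit_eq_decide_div_mod_eq, decide_eq_true_eq, Nat.div_eq_of_eq_mul_right
    (by positivity) hc]
  by_contra hne
  obtain ⟨d, hd⟩ : 2 ∣ c := by omega
  exact hnd ⟨d, by rw [pow_succ, mul_assoc, ← hd]; exact hc⟩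

theorem padicValNat_le_of_testBit {x i : ℕ} (h : x.testBit i = true) : padicValNat 2 x ≤ i := by
  obtain ⟨c, hc⟩ : 2 ^ padicValNat 2 x ∣ x := pow_padicValNat_dvd
  rw [hc, mul_comm, Nat.testBit_mul_two_pow, Bool.and_eq_true, decide_eq_true_iff] at h
  exact h.1

/-- One round of the bit loops: the 2-adic valuation is the index of the lowest set bit. Both lists
are strictly increasing with the same members, hence equal. -/
theorem setBits_eq_cons {x : ℕ} (hx : x ≠ 0) :
    setBits x = padicValNat 2 x :: setBits (x ^^^ lowestBitMask x) := by
  have hmem : ∀ i, i ∈ setBits (x ^^^ lowestBitMask x) ↔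
      x.testBit i = true ∧ i ≠ padicValNat 2 x := by
    intro i
    rw [mem_setBits, lowestBitMask, Nat.testBit_xor, Nat.testBit_two_pow]
    by_cases h : padicValNat 2 x = i
    · subst h
      simp [testBit_padicValNat hx]
    · simp [h, Ne.symm h]
  refine (pairwise_setBits x).eq_of_mem_iff (List.pairwise_cons.2 ⟨?_, pairwise_setBits _⟩) ?_
  · intro i hi
    rw [hmem] at hi
    exact lt_of_le_of_ne (padicValNat_le_of_testBit hi.1) hi.2.symm
  · intro i
    rw [List.mem_cons, hmem, mem_setBits]
    by_cases h : i = padicValNat 2 x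
    · simp [h, testBit_padicValNat hx]
    · simp [h]

theorem setBits_zero : setBits 0 = [] := rfl

theorem indexOfTheOnlyBit_lowestBitMask (x : ℕ) :
    indexOfTheOnlyBit (lowestBitMask x) = padicValNat 2 x := Nat.log2_two_pow

theorem foldlBits_eq {β : Type*} (pre : ℕ) (f : β → ℕ → β) (z : β) (bm : ℕ) :
    foldlBits pre f z bm = ((setBits bm).map (pre + ·)).foldl f z := by
  rw [foldlBits]
  induction bm using Nat.strong_induction_on generalizing z with
  | _ bm ih =>
    rw [foldlBitsGo]
    split_ifs with h
    · rw [h, setBits_zero, List.map_nil, List.foldl_nil]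
    · rw [ih _ (xor_lowestBitMask_lt h), setBits_eq_cons h, indexOfTheOnlyBit_lowestBitMask,
        List.map_cons, List.foldl_cons]

/-- The loop accumulates from the lowest bit upwards, so it is a left fold with the arguments of `f`
exchanged. -/
theorem foldrBitsGo_eq {β : Type*} (k pre : ℕ) (f : ℕ → β → β) (z : β) (bm : ℕ) :
    foldrBitsGo k pre f bm z =
      ((setBits bm).map (pre + (width k - 1) - ·)).foldl (fun a i => f i a) z := by
  induction bm using Nat.strong_induction_on generalizing z with
  | _ bm ih =>
    rw [foldrBitsGo]
    split_ifs with h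
    · rw [h, setBits_zero, List.map_nil, List.foldl_nil]
    · rw [ih _ (xor_lowestBitMask_lt h), setBits_eq_cons h, indexOfTheOnlyBit_lowestBitMask,
        List.map_cons, List.foldl_cons]

theorem testBit_swapMask (k i j : ℕ) :
    (swapMask k i).testBit j = (decide (j < width k) && !j.testBit i) := by
  rw [swapMask]
  by_cases h : j < width k
  · rw [Nat.testBit_ofBits_lt _ _ h]
    simp [h]
  · rw [Nat.testBit_ofBits_ge _ _ (not_lt.1 h)]
    simp [h]

theorem testBit_add_two_pow_self (j i : ℕ) : (j + 2 ^ i).testBit i = !j.testBit i := by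
  rw [add_comm, Nat.testBit_two_pow_add_eq]

/-- The block number `j / 2 ^ i` is even and below the even number `2 ^ (k - i)`, so the next block
still fits in the word. -/
theorem lt_width_of_testBit_eq_false {k i j : ℕ} (hi : i < k) (hj : j < width k)
    (h : j.testBit i = false) : j + 2 ^ i < width k := by
  have h₁ : j / 2 ^ i + 1 < 2 ^ (k - i) := by
    have hlt : j / 2 ^ i < 2 ^ (k - i) := by
      rw [Nat.div_lt_iff_lt_mul (by positivity), ← pow_add, Nat.sub_add_cancel hi.le]
      exact hj
    have he : 2 ^ (k - i) = 2 * 2 ^ (k - i - 1) := by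
      rw [← pow_succ', Nat.sub_add_cancel (by omega)]
    rw [Nat.testBit_eq_decide_div_mod_eq, decide_eq_false_iff_not] at h
    have key : ∀ q u v : ℕ, q < u → u = 2 * v → ¬ q % 2 = 1 → q + 1 < u := by omega
    exact key _ _ _ hlt he h
  have h₂ : (j + 2 ^ i) / 2 ^ i < 2 ^ (k - i) := by
    rwa [Nat.add_div_right _ (by positivity)]
  rwa [Nat.div_lt_iff_lt_mul (by positivity), ← pow_add, Nat.sub_add_cancel hi.le] at h₂

/-- The left-shifted part contributes nothing here: its source `j - 2 ^ i`, if it exists, has bit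
`i` set and is masked out. -/
theorem testBit_swapBlocks_of_false {k i j : ℕ} (x : ℕ) (hj : j < width k)
    (h : j.testBit i = false) : (swapBlocks k i x).testBit j = x.testBit (j + 2 ^ i) := by
  rw [swapBlocks, Nat.testBit_or, Nat.testBit_and, Nat.testBit_shiftRight, Nat.testBit_shiftLeft,
    Nat.testBit_and, testBit_swapMask, testBit_swapMask, add_comm (2 ^ i)]
  have h' : ¬ (2 ^ i ≤ j ∧ (j - 2 ^ i).testBit i = false) := by
    rintro ⟨hle, hb⟩
    have := testBit_add_two_pow_self (j - 2 ^ i) i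
    rw [Nat.sub_add_cancel hle, h, hb] at this
    simp at this
  by_cases hle : 2 ^ i ≤ j
  · have : (j - 2 ^ i).testBit i = true := by simpa [hle] using h'
    simp [h, hj, this]
  · simp [h, hj, hle]

theorem testBit_swapBlocks_of_true {k i j : ℕ} (x : ℕ) (hj : j + 2 ^ i < width k)
    (h : j.testBit i = false) : (swapBlocks k i x).testBit (j + 2 ^ i) = x.testBit j := by
  have hj' : j < width k := (Nat.le_add_right _ _).trans_lt hj
  rw [swapBlocks, Nat.testBit_or, Nat.testBit_and, Nat.testBit_shiftLeft,
    Nat.testBit_and, testBit_swapMask, testBit_swapMask, testBit_add_two_pow_self,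
    Nat.add_sub_cancel]
  simp [h, hj']

theorem swapBlocks_lt {k i : ℕ} (hi : i < k) (x : ℕ) : swapBlocks k i x < 2 ^ width k := by
  refine Nat.lt_pow_two_of_testBit _ fun j hj => ?_
  rw [swapBlocks, Nat.testBit_or, Nat.testBit_and, Nat.testBit_shiftLeft,
    Nat.testBit_and, testBit_swapMask, testBit_swapMask]
  by_cases hle : 2 ^ i ≤ j
  · by_cases hlt : j - 2 ^ i < width k
    · cases hb : (j - 2 ^ i).testBit i
      · have := lt_width_of_testBit_eq_false hi hlt hb
        omega
      · simp [hj.not_gt]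
    · simp [hj.not_gt, hlt]
  · simp [hj.not_gt, hle]

theorem testBit_mul_two_pow_succ_add {a i c : ℕ} (hc : c < 2 ^ i) :
    (a * 2 ^ (i + 1) + c).testBit i = false := by
  have h : (a * 2 ^ (i + 1) + c) / 2 ^ i = 2 * a := by
    rw [pow_succ, show a * (2 ^ i * 2) + c = c + 2 ^ i * (2 * a) by ring,
      Nat.add_mul_div_left _ _ (by positivity), Nat.div_eq_of_lt hc, zero_add]
  rw [Nat.testBit_eq_decide_div_mod_eq, h]
  simp

/-- Loop invariant: after `i` rounds every aligned block of `2 ^ i` bits is reversed in place. Here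
`a` numbers the block and `c` is the offset in it. Exchanging two adjacent reversed blocks reverses
their concatenation. -/
theorem testBit_revNatSteps {k i : ℕ} (hi : i ≤ k) (x a c : ℕ) (hc : c < 2 ^ i)
    (h : a * 2 ^ i + c < width k) :
    (revNatSteps k i x).testBit (a * 2 ^ i + c) = x.testBit (a * 2 ^ i + (2 ^ i - 1 - c)) := by
  induction i generalizing a c with
  | zero =>
    obtain rfl : c = 0 := by simpa using hc
    simp [revNatSteps]
  | succ i ih =>
    rw [revNatSteps]
    have e : 2 ^ (i + 1) = 2 ^ i + 2 ^ i := by ring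
    by_cases hci : c < 2 ^ i
    · have hb := testBit_mul_two_pow_succ_add (a := a) hci
      have hlt := lt_width_of_testBit_eq_false hi h hb
      -- An offset in the lower half reads from the odd-numbered block `2 * a + 1` of the previous
      -- round.
      have e₁ : a * 2 ^ (i + 1) + c + 2 ^ i = (2 * a + 1) * 2 ^ i + c := by ring
      rw [testBit_swapBlocks_of_false _ h hb, e₁, ih (by omega) _ _ hci (e₁ ▸ hlt)]
      congr 1
      rw [show 2 ^ (i + 1) - 1 - c = 2 ^ i + (2 ^ i - 1 - c) by omega]
      ring
    · obtain ⟨d, rfl⟩ := Nat.exists_eq_add_of_le (not_lt.1 hci)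
      have hd : d < 2 ^ i := by omega
      have hb := testBit_mul_two_pow_succ_add (a := a) hd
      have e₁ : a * 2 ^ (i + 1) + (2 ^ i + d) = a * 2 ^ (i + 1) + d + 2 ^ i := by ring
      have e₂ : a * 2 ^ (i + 1) + d = (2 * a) * 2 ^ i + d := by ring
      rw [e₁] at h
      rw [e₁, testBit_swapBlocks_of_true _ h hb, e₂, ih (by omega) _ _ hd (by omega)]
      congr 1
      rw [show 2 ^ (i + 1) - 1 - (2 ^ i + d) = 2 ^ i - 1 - d by omega]
      ring

theorem testBit_revNat {k j : ℕ} (x : ℕ) (hj : j < width k) :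
    (revNat k x).testBit j = x.testBit (width k - 1 - j) := by
  simpa [revNat, width] using testBit_revNatSteps le_rfl x 0 j hj (by simpa using hj)

theorem revNat_lt {k x : ℕ} (hx : x < 2 ^ width k) : revNat k x < 2 ^ width k := by
  cases k with
  -- For `k = 0` no exchange takes place, so the bound can only come from the hypothesis.
  | zero => exact hx
  | succ k => exact swapBlocks_lt (Nat.lt_succ_self k) _

theorem lt_of_testBit_of_lt_two_pow {x n i : ℕ} (hx : x < 2 ^ n) (h : x.testBit i = true) :
    i < n :=
  (Nat.pow_lt_pow_iff_right one_lt_two).1 ((Nat.ge_two_pow_of_testBit h).trans_lt hx)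

/-- The reflection `i ↦ width k - 1 - i` reverses the order, so both sides are increasing lists with
the same members. -/
theorem setBits_revNat {k x : ℕ} (hx : x < 2 ^ width k) :
    setBits (revNat k x) = ((setBits x).map (width k - 1 - ·)).reverse := by
  refine (pairwise_setBits _).eq_of_mem_iff ?_ ?_
  · rw [List.pairwise_reverse, List.pairwise_map]
    refine (pairwise_setBits x).imp_of_mem fun {i j} _ hj hij => ?_
    have := lt_of_testBit_of_lt_two_pow hx (mem_setBits.1 hj)
    omega
  · intro i
    rw [List.mem_reverse, List.mem_map, mem_setBits]
    constructor
    · intro h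
      have hi := lt_of_testBit_of_lt_two_pow (revNat_lt hx) h
      rw [testBit_revNat x hi] at h
      exact ⟨_, mem_setBits.2 h, by omega⟩
    · rintro ⟨j, hj, rfl⟩
      rw [mem_setBits] at hj
      have := lt_of_testBit_of_lt_two_pow hx hj
      rw [testBit_revNat x (by omega), show width k - 1 - (width k - 1 - j) = j by omega, hj]

theorem foldrBits_eq {β : Type*} {k bm : ℕ} (hbm : bm < 2 ^ width k) (pre : ℕ) (f : ℕ → β → β)
    (z : β) : foldrBits k pre f z bm = ((setBits bm).map (pre + ·)).foldr f z := by
  have h : (setBits (revNat k bm)).map (pre + (width k - 1) - ·) =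
      ((setBits bm).map (pre + ·)).reverse := by
    rw [setBits_revNat hbm, List.map_reverse, List.map_map]
    congr 1
    refine List.map_congr_left fun i hi => ?_
    -- The truncated subtractions cancel only because `i` is below the width.
    have := lt_of_testBit_of_lt_two_pow hbm (mem_setBits.1 hi)
    simp only [Function.comp]
    omega
  rw [foldrBits, foldrBitsGo_eq, h, List.foldl_reverse]

/-! ### Folds -/

/-- The elements of a tree, in the order of its leaves. -/
def elements : IntSet → List ℕ
  | Bin _ _ l r => elements l ++ elements r
  | Tip kx bm => (setBits bm).map (kx + ·)
  | Nil => []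

theorem foldlGo_eq {β : Type*} (f : β → ℕ → β) (z : β) (s : IntSet) :
    foldlGo f z s = (elements s).foldl f z := by
  induction s generalizing z with
  | Bin p m l r ihl ihr => rw [foldlGo, ihl, ihr, elements, List.foldl_append]
  | Tip kx bm => rw [foldlGo, foldlBits_eq, elements]
  | Nil => rfl

/-- Unlike the left fold, this needs a description: reversal is faithful only for bitmaps that fit
in the word. -/
theorem Desc.foldrGo_eq {β : Type*} (h : Desc k s r D) (f : ℕ → β → β) (z : β) :
    foldrGo k f z s = (elements s).foldr f z := by
  induction h generalizing z with
  | tip hp hpos hlt hD => rw [foldrGo, foldrBits_eq hlt, elements]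
  | bin h₁ h₂ hr₁ hr₂ hb hp hm hD ih₁ ih₂ => rw [foldrGo, ih₁, ih₂, elements, List.foldr_append]

theorem Sem.foldr_eq {β : Type*} (h : Sem k s D) (f : ℕ → β → β) (z : β) :
    foldr k f z s = (elements s).foldr f z := by
  cases h with
  | nil => rfl
  | desc h => exact h.foldrGo_eq f z

theorem Sem.toList_eq (h : Sem k s D) : toList k s = elements s := by
  rw [toList, h.foldr_eq, List.foldr_cons_nil]

theorem Desc.mem_elements_iff (h : Desc k s r D) (x : ℕ) : x ∈ elements s ↔ x ∈ D := by
  induction h with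
  | tip hp hpos hlt hD =>
    subst hp hD
    simp only [elements, List.mem_map, mem_setBits, Set.mem_ofPred_eq, eq_comm]
  | bin h₁ h₂ hr₁ hr₂ hb hp hm hD ih₁ ih₂ =>
    rw [elements, List.mem_append, ih₁, ih₂, hD, Set.mem_union]

theorem Desc.nodup_elements (h : Desc k s r D) : (elements s).Nodup := by
  induction h with
  | tip hp hpos hlt hD =>
    exact List.Nodup.map (add_right_injective _) ((pairwise_setBits _).imp ne_of_lt)
  | @bin a₁ a₂ q₁ q₂ E₁ E₂ E p b p' m h₁ h₂ hr₁ hr₂ hb hp hm hD ih₁ ih₂ =>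
    rw [elements]
    refine ih₁.append ih₂ fun x hx₁ hx₂ => ?_
    rw [h₁.mem_elements_iff] at hx₁
    rw [h₂.mem_elements_iff] at hx₂
    exact Set.disjoint_left.1 (disjoint_halves (r := mk p b) hb) (hr₁ (h₁.subset hx₁))
      (hr₂ (h₂.subset hx₂))

theorem Sem.mem_elements_iff (h : Sem k s D) (x : ℕ) : x ∈ elements s ↔ x ∈ D := by
  cases h with
  | nil => simp [elements]
  | desc h => exact h.mem_elements_iff x

theorem Sem.nodup_elements (h : Sem k s D) : (elements s).Nodup := by
  cases h with
  | nil => exact List.nodup_nil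
  | desc h => exact h.nodup_elements

theorem sizeGo_eq (n : ℕ) (s : IntSet) : sizeGo n s = n + (elements s).length := by
  induction s generalizing n with
  | Bin p m l r ihl ihr => rw [sizeGo, ihl, ihr, elements, List.length_append, add_assoc]
  | Tip kx bm => rw [sizeGo, bitcount, popCount_eq_length, elements, List.length_map, zero_add]
  | Nil => rfl

/-- Stated with `encard` so that finiteness of the set is part of the conclusion. -/
theorem Sem.encard_eq (h : Sem k s D) : D.encard = (size s : ℕ∞) := by
  have e : D = ((elements s).toFinset : Set ℕ) := by
    ext x
    simp [h.mem_elements_iff]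
  rw [e, Set.encard_coe_eq_coe_finsetCard, List.toFinset_card_of_nodup h.nodup_elements, size,
    sizeGo_eq, zero_add]

/-! ### Filter -/

theorem testBit_foldl_filter (q : ℕ → Bool) (l : List ℕ) (a j : ℕ) :
    (l.foldl (fun acc i => if q i then acc ||| bitmapOfSuffix i else acc) a).testBit j = true ↔
      a.testBit j = true ∨ (j ∈ l ∧ q j = true) := by
  induction l generalizing a with
  | nil => simp
  | cons i l ih =>
    rw [List.foldl_cons, ih, List.mem_cons]
    by_cases hq : q i = true
    · rw [if_pos hq, bitmapOfSuffix, Nat.one_shiftLeft, Nat.testBit_or, Nat.testBit_two_pow,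
        Bool.or_eq_true, decide_eq_true_iff]
      by_cases hij : j = i
      · subst hij
        simp [hq]
      · simp [hij, Ne.symm hij]
    · rw [if_neg hq]
      by_cases hij : j = i
      · subst hij
        simp [hq]
      · simp [hij]

theorem descO_filter (h : Desc k s r D) (f : ℕ → Bool) :
    DescO k (filter f s) r {x ∈ D | f x = true} := by
  induction h with
  | @tip p kx bm E hp hpos hlt hD =>
    have h := Desc.tip hp hpos hlt hD
    obtain ⟨-, -, -, -, hE⟩ := h.tip_inv
    have hbit : ∀ j, (foldlBits 0 (fun acc bi => if f (kx + bi) then acc ||| bitmapOfSuffix bi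
        else acc) 0 bm).testBit j = true ↔ bm.testBit j = true ∧ f (kx + j) = true := by
      intro j
      rw [foldlBits_eq, testBit_foldl_filter (fun i => f (kx + i))]
      simp [mem_setBits]
    rw [filter]
    subst hp
    refine descO_tip ?_ fun x => ?_
    · refine Nat.lt_pow_two_of_testBit _ fun j hj => ?_
      -- Every surviving bit was already set in `bm`, so the filtered bitmap still fits in the word.
      by_contra hn
      rw [Bool.not_eq_false, hbit] at hn
      exact hj.not_gt (lt_of_testBit_of_lt_two_pow hlt hn.1)
    · rw [Set.mem_ofPred_eq, hE, hbit, and_assoc]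
      refine and_congr_right fun hx => ?_
      obtain rfl : x / 2 ^ k = p := hx
      rw [show x / 2 ^ k * width k + x % 2 ^ k = x from Nat.div_add_mod' x (2 ^ k)]
  | @bin a₁ a₂ q₁ q₂ E₁ E₂ E p b p' m h₁ h₂ hr₁ hr₂ hb hp hm hD ih₁ ih₂ =>
    subst hp hm hD
    have e : {x ∈ E₁ ∪ E₂ | f x = true} = {x ∈ E₁ | f x = true} ∪ {x ∈ E₂ | f x = true} := by
      ext x
      simp [or_and_right]
    rw [filter, e]
    exact descO_bin hb (ih₁.mono hr₁) (ih₂.mono hr₂)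

theorem sem_filter (h : Sem k s D) (f : ℕ → Bool) :
    Sem k (filter f s) {x ∈ D | f x = true} := by
  cases h with
  | nil =>
    have e : {x ∈ (∅ : Set ℕ) | f x = true} = ∅ := by
      ext x
      simp
    rw [e]
    exact .nil
  | desc h => exact (descO_filter h f).sem

end Patricia

/-! ### The correctness theorem. -/

theorem mainTheorem2 (k : ℕ) :
    -- dyadic intervals
    ((∀ r : Patricia.DyadicInterval, r.toSet.Nonempty) ∧
      (∀ r₁ r₂ : Patricia.DyadicInterval, Disjoint r₁.toSet r₂.toSet ∨ r₁ ≤ r₂ ∨ r₂ ≤ r₁) ∧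
      (∀ r : Patricia.DyadicInterval, 0 < r.b →
        r.lowerHalf.toSet ∪ r.upperHalf.toSet = r.toSet ∧
        Disjoint r.lowerHalf.toSet r.upperHalf.toSet) ∧
      (∀ r r' : Patricia.DyadicInterval, 0 < r.b →
        (r'.toSet ∩ r.lowerHalf.toSet).Nonempty → (r'.toSet ∩ r.upperHalf.toSet).Nonempty →
        r ≤ r') ∧
      (∀ r₁ r₂ : Patricia.DyadicInterval, ∃ r, IsLUB {r₁, r₂} r)) ∧
    -- descriptions: non-emptiness, bounds, and the least interval at the granularity of a bitmap
    (∀ s r D, Patricia.Desc k s r D →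
      D.Nonempty ∧ D ⊆ r.toSet ∧
      ∀ r' : Patricia.DyadicInterval, k ≤ r'.b → D ⊆ r'.toSet → r ≤ r') ∧
    -- uniqueness of the representation
    (∀ s₁ s₂ r₁ r₂ D, Patricia.Desc k s₁ r₁ D → Patricia.Desc k s₂ r₂ D → r₁ = r₂ ∧ s₁ = s₂) ∧
    (∀ s₁ s₂ D, Patricia.Sem k s₁ D → Patricia.Sem k s₂ D → s₁ = s₂) ∧
    -- queries
    (∀ s D, Patricia.Sem k s D → ∀ x, Patricia.member k x s = true ↔ x ∈ D) ∧
    (∀ s₁ s₂ D₁ D₂, Patricia.Sem k s₁ D₁ → Patricia.Sem k s₂ D₂ →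
      (Patricia.null s₁ = true ↔ D₁ = ∅) ∧
      D₁.encard = (Patricia.size s₁ : ℕ∞) ∧
      ((Patricia.toList k s₁).Nodup ∧ ∀ x, x ∈ Patricia.toList k s₁ ↔ x ∈ D₁) ∧
      (Patricia.equal s₁ s₂ = true ↔ D₁ = D₂) ∧
      (Patricia.nequal s₁ s₂ = true ↔ D₁ ≠ D₂) ∧
      (Patricia.isSubsetOf s₁ s₂ = true ↔ D₁ ⊆ D₂)) ∧
    -- set-returning operations
    (∀ x, Patricia.Sem k (Patricia.singleton k x) {x}) ∧
    (∀ s₁ s₂ D₁ D₂, Patricia.Sem k s₁ D₁ → Patricia.Sem k s₂ D₂ →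
      (∀ x, Patricia.Sem k (Patricia.insert k x s₁) (D₁ ∪ {x})) ∧
      (∀ x, Patricia.Sem k (Patricia.delete k x s₁) (D₁ \ {x})) ∧
      Patricia.Sem k (Patricia.union s₁ s₂) (D₁ ∪ D₂) ∧
      Patricia.Sem k (Patricia.intersection s₁ s₂) (D₁ ∩ D₂) ∧
      Patricia.Sem k (Patricia.difference s₁ s₂) (D₁ \ D₂) ∧
      (∀ f : ℕ → Bool, Patricia.Sem k (Patricia.filter f s₁) {x ∈ D₁ | f x = true})) ∧
    (∀ xs : List ℕ, Patricia.Sem k (Patricia.fromList k xs) {x | x ∈ xs}) ∧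
    -- folds
    (∀ s, Patricia.WF k s → ∀ (β : Type*) (n : β),
      (∀ f : ℕ → β → β,
        Patricia.foldr k f n s = List.foldr f n (Patricia.toList k s)) ∧
      (∀ f : β → ℕ → β,
        Patricia.foldl f n s = List.foldl f n (Patricia.toList k s))) ∧
    -- the dyadic intervals of a union and of an intersection
    (∀ s₁ s₂ r₁ r₂ D₁ D₂, Patricia.Desc k s₁ r₁ D₁ → Patricia.Desc k s₂ r₂ D₂ →
      (∀ r, IsLUB {r₁, r₂} r → Patricia.Desc k (Patricia.union s₁ s₂) r (D₁ ∪ D₂)) ∧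
      Patricia.DescO k (Patricia.intersection s₁ s₂) r₁ (D₁ ∩ D₂)) := by
  open Patricia in
  refine ⟨⟨DyadicInterval.toSet_nonempty, DyadicInterval.disjoint_or_le_or_le,
      fun r hr => ⟨DyadicInterval.union_halves hr, DyadicInterval.disjoint_halves hr⟩,
      fun r r' hr h₁ h₂ => DyadicInterval.le_of_meets_halves hr h₁ h₂,
      DyadicInterval.exists_isLUB⟩,
    fun s r D h => ⟨h.nonempty, h.subset, fun r' hb hD => h.le_of_subset hb hD⟩,
    fun s₁ s₂ r₁ r₂ D h₁ h₂ => ⟨h₁.interval_unique h₂, h₁.tree_unique h₂⟩,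
    fun s₁ s₂ D h₁ h₂ => h₁.tree_unique h₂,
    fun s D h x => h.member_iff x,
    fun s₁ s₂ D₁ D₂ h₁ h₂ => ⟨h₁.null_iff, h₁.encard_eq,
      ⟨h₁.toList_eq ▸ h₁.nodup_elements, fun x => h₁.toList_eq ▸ h₁.mem_elements_iff x⟩,
      h₁.equal_iff h₂, ?_, h₁.isSubsetOf_iff h₂⟩,
    fun x => .desc (desc_singleton k x),
    fun s₁ s₂ D₁ D₂ h₁ h₂ => ⟨sem_insert h₁, sem_delete h₁, sem_union h₁ h₂,
      sem_intersection h₁ h₂, sem_difference h₁ h₂, sem_filter h₁⟩,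
    sem_fromList k,
    fun s ⟨D, h⟩ β n => ⟨fun f => ?_, fun f => ?_⟩,
    fun s₁ s₂ r₁ r₂ D₁ D₂ h₁ h₂ => ⟨fun r hr => desc_union h₁ h₂ hr, descO_intersection h₁ h₂⟩⟩
  · rw [Patricia.nequal_eq_not_equal, Bool.not_eq_true', ← Bool.not_eq_true, ne_eq,
      h₁.equal_iff h₂]
  · rw [h.toList_eq, h.foldr_eq]
  · rw [h.toList_eq, Patricia.foldl, Patricia.foldlGo_eq]
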